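/- **Setting.** Let $V=\mathbb{C}^\ell$ and let $G\subset GL(V)$ be a nontrivial finite group generated by (complex) reflections, with set $\mathcal{A}$ of reflecting hyperplanes. For $H\in\mathcal A$ let $e_H$ be the order of the pointwise stabiliser of $H$ in $G$ and let $\ell_H$ be a linear form with kernel $H$. Put $Q=\prod_{H\in\mathcal A}\ell_H^{e_H}$, $m=\deg Q\ (\geq 1)$, $F=Q^{-1}(1)\subset V$ and $\Gamma=G\times\mu_m$, acting on $V$ by $(g,\xi)v=\xi^{-1}gv$. For $d\ge 1$ let $\zeta_d=e^{2\pi i/d}$ and $V(g,\zeta)=\ker(g-\zeta)$. The number $d$ is *regular* if some $V(g,\zeta_d)$, $g\in G$, contains a vector lying on no $H\in\mathcal A$. Let $d_1,\dots,d_\ell$ be the invariant degrees of $G$, and let $\mathcal P$ be the set of regular $d$ with $d=\gcd\{d_i: d\mid d_i\}$. Let $F(d)=F\cap\bigcup_{g\in G}V(g,\zeta_d)$ and $F(d)^\circ=F(d)\setminus\bigcup_{e\in\mathcal P,\,d\mid e,\,e\ne d}F(e)$. For each $d\in\mathcal P$ let $E_d=V(g_d,\zeta_d)$ be any $\zeta_d$-eigenspace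 which is maximal under inclusion among the $V(g,\zeta_d)$, $g\in G$; put $(F\cap E_d)^\circ=F(d)^\circ\cap E_d$, $G(d)=C_G(g_d)$ and $\Gamma(d)=G(d)\times\mu_m$. For a finite group $H$ let $R(H)$ be its complex Grothendieck ring, i.e. the algebra of complex class functions on $H$, and let $A$ be a commutative $\mathbb{C}$-algebra. For $\gamma\in H$ the trace at $\gamma$ is the map $A\otimes_{\mathbb C} R(H)\to A$, $a\otimes\chi\mapsto\chi(\gamma)a$. Constructible subsets are finite Boolean combinations of zero sets of polynomials. An *additive $\Gamma$-functor* $\beta$ on the constructible subsets of $F$, with coefficients in $A$, assigns to every constructible $Y\subseteq F$ and every subgroup $H\le\Gamma$ stabilising $Y$ an element $\beta_H(Y)\in A\otimes_{\mathbb C} R(H)$, such that * (functoriality) $\mathrm{Res}^H_K\beta_H(Y)=\beta_K(Y)$ for $K\le H$, and $\beta(\gamma Y)=\gamma(\beta(Y))$ for $\gamma\in\Gamma$, i.e. conjugation by $\gamma$ carries $\beta_H(Y)$ to $\beta_{\gamma H\gamma^{-1}}(\gamma Y)$; * (additivity) $\beta_H(Y)=\beta_H(Z)+\beta_H(Y\setminus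 Z)$ whenever $Z\subseteq Y$ are constructible and stable under $H$; * (permuted pieces) if $\gamma\in\Gamma$ permutes the parts of a finite partition of $Y$ into constructible sets and fixes none of these parts, then the trace at $\gamma$ of $\beta_{\langle\gamma\rangle}(Y)$ is $0$. **Statement.** The set $F$ is $\Gamma$-stable, $\mathcal P$ is finite, and for each $d\in\mathcal P$ the group $\Gamma(d)$ is the stabiliser of $(F\cap E_d)^\circ$ in $\Gamma$. Moreover: 1. For every additive $\Gamma$-functor $\beta$ with coefficients in a commutative $\mathbb{C}$-algebra $A$, $$\beta_\Gamma(F)=\sum_{d\in\mathcal P}\mathrm{Ind}_{\Gamma(d)}^{\Gamma}\,\beta_{\Gamma(d)}\big((F\cap E_d)^\circ\big)\quad\text{in } A\otimes_{\mathbb C} R(\Gamma).$$ Likewise, if $S$ is any $\Gamma$-module and $\beta$ is an $S$-valued function on the constructible subsets of $F$ with $\beta(Y)=\beta(Z)+\beta(Y\setminus Z)$ for all constructible $Z\subseteq Y\subseteq F$ and $\beta(\gamma Y)=\gamma\beta(Y)$ for all $\gamma\in\Gamma$, then $$\beta(F)=\sum_{d\in\mathcal P}\ \sum_{\gamma\in\Gamma/\Gamma(d)}\gamma\,\beta\big((F\cap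 E_d)^\circ\big).$$ 2. For each $d\in\mathcal P$, $\zeta_d\in\mu_m$, the cyclic group $R(d)=\langle(g_d,\zeta_d)\rangle$ is a normal subgroup of $\Gamma(d)$ acting trivially on $(F\cap E_d)^\circ$, and $\Gamma(d)/R(d)$ acts freely on $(F\cap E_d)^\circ$. -/

import Mathlib

open scoped TensorProduct Pointwise

noncomputable section

namespace MilnorDecomp

/-! ### The complex Grothendieck ring of a finite group, restriction and induction -/

/-- The complex Grothendieck ring `R(H)` of a finite group `H`, realised through characters as the
algebra of complex class functions on `H` (with pointwise operations). -/
def RepRing (H : Type*) [Group H] : Subalgebra ℂ (H → ℂ) where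
  carrier := {f | ∀ x y : H, f (y * x * y⁻¹) = f x}
  mul_mem' hf hg x y := by simp [hf x y, hg x y]
  add_mem' hf hg x y := by simp [hf x y, hg x y]
  algebraMap_mem' c x y := by simp

/-- The character of a finite-dimensional representation, as an element of `R(H)`. -/
def RepRing.ofRep {H W : Type*} [Group H] [AddCommGroup W] [Module ℂ W] [FiniteDimensional ℂ W]
    (ρ : Representation ℂ H W) : RepRing H :=
  ⟨ρ.character, fun x y => ρ.char_conj x y⟩

/-- Pull-back `R(L) → R(K)` along a group homomorphism `K → L`; for an inclusion of subgroups this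
is restriction. -/
def RepRing.res {K L : Type*} [Group K] [Group L] (φ : K →* L) : RepRing L →ₗ[ℂ] RepRing K where
  toFun f := ⟨fun x => f.1 (φ x), fun x y => by simpa using f.2 (φ x) (φ y)⟩
  map_add' _ _ := rfl
  map_smul' _ _ := rfl

/-- The extension by zero to `Γ` of a function on a subgroup `K`. -/
def extendZero {Γ : Type*} [Group Γ] (K : Subgroup Γ) (f : K → ℂ) (x : Γ) : ℂ :=
  open Classical in if h : x ∈ K then f ⟨x, h⟩ else 0

/-- Induction `Ind_K^L : R(K) → R(L)` for subgroups `K ≤ L` of a finite group: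
`(Ind f)(x) = |K|⁻¹ ∑_{y ∈ L, y⁻¹ x y ∈ K} f(y⁻¹ x y)`. -/
def RepRing.ind {Γ : Type*} [Group Γ] [Finite Γ] {K L : Subgroup Γ} (_h : K ≤ L) :
    RepRing K →ₗ[ℂ] RepRing L where
  toFun f := ⟨fun x => (Nat.card K : ℂ)⁻¹ *
      ∑ᶠ y : L, extendZero K f.1 ((y⁻¹ * x * y : L) : Γ), fun x z => by
    change _ * _ = _ * _
    rw [← finsum_comp_equiv (Equiv.mulLeft z)]
    congr 1
    refine finsum_congr fun y => ?_
    congr 2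
    simp only [Equiv.coe_mulLeft]
    group⟩
  map_add' f g := by
    apply Subtype.ext
    funext x
    have h : ∀ w : Γ, extendZero K (f.1 + g.1) w = extendZero K f.1 w + extendZero K g.1 w := by
      intro w
      unfold extendZero
      split_ifs <;> simp
    simp only [h, AddMemClass.coe_add, Pi.add_apply]
    rw [finsum_add_distrib (Set.toFinite _) (Set.toFinite _), mul_add]
  map_smul' c f := by
    apply Subtype.ext
    funext x
    have h : ∀ w : Γ, extendZero K (c • f).1 w = c * extendZero K f.1 w := by
      intro w
      unfold extendZero
      split_ifs <;> simp
    change _ * _ = c * (_ * _)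
    simp only [h]
    rw [← mul_finsum]
    ring

/-- The trace at `x ∈ H` of an element of `A ⊗ R(H)`, i.e. `a ⊗ χ ↦ χ(x) a`. -/
def trace (A : Type*) [CommRing A] [Algebra ℂ A] {H : Type*} [Group H] (x : H) :
    A ⊗[ℂ] RepRing H →ₗ[ℂ] A :=
  (TensorProduct.rid ℂ A).toLinearMap ∘ₗ
    LinearMap.lTensor A ((LinearMap.proj x : (H → ℂ) →ₗ[ℂ] ℂ) ∘ₗ (RepRing H).val.toLinearMap)

/-! ### Additive functors -/

/-- Let `Γ` act on `X` and let `B` be a Boolean algebra (of constructible subsets of `X`).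
An additive `Γ`-functor from `B` to the complex Grothendieck rings with coefficients in the
`ℂ`-algebra `A`: every `Y ∈ B` stable under a subgroup `H ≤ Γ` has a value `β_H(Y) ∈ A ⊗ R(H)`.
(Only the values at `Y ∈ B` and `H ≤ Γ_Y` are meaningful, and the axioms only speak of them.) -/
structure AdditiveFunctor (Γ : Type*) {X : Type*} [Group Γ] [MulAction Γ X] (B : Set (Set X))
    (A : Type*) [CommRing A] [Algebra ℂ A] where
  /-- the value `β_H(Y)` -/
  val : (H : Subgroup Γ) → Set X → A ⊗[ℂ] RepRing H
  /-- `β_K(Y)` is the restriction of `β_H(Y)` for `K ≤ H`. -/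
  res_val : ∀ (K H : Subgroup Γ) (hKH : K ≤ H) (Y : Set X), Y ∈ B →
    H ≤ MulAction.stabilizer Γ Y →
    LinearMap.lTensor A (RepRing.res (Subgroup.inclusion hKH)) (val H Y) = val K Y
  /-- `β(γY) = γ β(Y)`: the conjugation isomorphism `h ↦ γ h γ⁻¹` from `H` to `γ H γ⁻¹`
  identifies `β_{γHγ⁻¹}(γY)` with `β_H(Y)`. -/
  smul_val : ∀ (γ : Γ) (H : Subgroup Γ) (Y : Set X), Y ∈ B → H ≤ MulAction.stabilizer Γ Y →
    LinearMap.lTensor A (RepRing.res ((MulAut.conj γ).subgroupMap H).toMonoidHom)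
      (val (H.map ((MulAut.conj γ : Γ ≃* Γ) : Γ →* Γ)) (γ • Y)) = val H Y
  /-- `β(Y) = β(Z) + β(Y \ Z)` for `Z ⊆ Y`. -/
  additive : ∀ (H : Subgroup Γ) (Y Z : Set X), Y ∈ B → Z ∈ B → Z ⊆ Y →
    H ≤ MulAction.stabilizer Γ Y → H ≤ MulAction.stabilizer Γ Z →
    val H Y = val H Z + val H (Y \ Z)
  /-- An element permuting the parts of a finite partition of `Y` without fixing any part
  has trace zero on `β(Y)`. -/
  trace_permuted : ∀ (γ : Γ) (n : ℕ) (Z : Fin n → Set X) (σ : Equiv.Perm (Fin n)),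
    (∀ i, Z i ∈ B) → Pairwise (fun i j => Disjoint (Z i) (Z j)) →
    (∀ i, γ • Z i = Z (σ i)) → (∀ i, σ i ≠ i) →
    trace A (⟨γ, Subgroup.mem_zpowers γ⟩ : Subgroup.zpowers γ)
      (val (Subgroup.zpowers γ) (⋃ i, Z i)) = 0

/-! ### Reflection groups -/

variable {l : ℕ}

/-- The `ζ`-eigenspace `V(g, ζ)` of `g` in `V = ℂ^l`. -/
def eigenspace (g : (Fin l → ℂ) ≃ₗ[ℂ] (Fin l → ℂ)) (ζ : ℂ) : Submodule ℂ (Fin l → ℂ) :=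
  Module.End.eigenspace (g : (Fin l → ℂ) →ₗ[ℂ] (Fin l → ℂ)) ζ

/-- `g` is a reflection if its fixed space has codimension one. -/
def IsReflection (g : (Fin l → ℂ) ≃ₗ[ℂ] (Fin l → ℂ)) : Prop :=
  Module.finrank ℂ (eigenspace g 1) + 1 = l

/-- `G` is generated by reflections. -/
def IsReflectionGroup (G : Subgroup ((Fin l → ℂ) ≃ₗ[ℂ] (Fin l → ℂ))) : Prop :=
  Subgroup.closure {g | g ∈ G ∧ IsReflection g} = G

/-- The set `𝒜` of reflecting hyperplanes of `G`. -/
def hyperplanes (G : Subgroup ((Fin l → ℂ) ≃ₗ[ℂ] (Fin l → ℂ))) :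
    Set (Submodule ℂ (Fin l → ℂ)) :=
  {H | ∃ g ∈ G, IsReflection g ∧ H = eigenspace g 1}

/-- The order `e_H` of the pointwise stabiliser of `H` in `G`. -/
def hyperplaneOrder (G : Subgroup ((Fin l → ℂ) ≃ₗ[ℂ] (Fin l → ℂ)))
    (H : Submodule ℂ (Fin l → ℂ)) : ℕ :=
  Nat.card {g : G // ∀ v ∈ H, (g : (Fin l → ℂ) ≃ₗ[ℂ] (Fin l → ℂ)) v = v}

/-- A linear form on `ℂ^l` as a polynomial. -/
def linearFormPoly (α : (Fin l → ℂ) →ₗ[ℂ] ℂ) : MvPolynomial (Fin l) ℂ :=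
  ∑ i, MvPolynomial.C (α (Pi.single i 1)) * MvPolynomial.X i

/-- The polynomial `Q = ∏_{H ∈ 𝒜} ℓ_H ^ e_H`, for a family `form` of linear forms `ℓ_H`. -/
def definingPoly (G : Subgroup ((Fin l → ℂ) ≃ₗ[ℂ] (Fin l → ℂ)))
    (form : Submodule ℂ (Fin l → ℂ) → ((Fin l → ℂ) →ₗ[ℂ] ℂ)) : MvPolynomial (Fin l) ℂ :=
  ∏ᶠ H ∈ hyperplanes G, linearFormPoly (form H) ^ hyperplaneOrder G H

/-- The Milnor fibre `{v | q v = 1}` of a polynomial `q`. -/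
def milnorFibre (q : MvPolynomial (Fin l) ℂ) : Set (Fin l → ℂ) :=
  {v | MvPolynomial.eval v q = 1}

/-- `deg` lists the invariant degrees of `G`, i.e. the degrees of a system of basic invariants:
algebraically independent homogeneous generators of the algebra of `G`-invariant polynomials. -/
def IsInvariantDegrees (G : Subgroup ((Fin l → ℂ) ≃ₗ[ℂ] (Fin l → ℂ))) (deg : Fin l → ℕ) : Prop :=
  ∃ f : Fin l → MvPolynomial (Fin l) ℂ,
    (∀ i, (f i).IsHomogeneous (deg i)) ∧ AlgebraicIndependent ℂ f ∧
    ∀ p : MvPolynomial (Fin l) ℂ, p ∈ Algebra.adjoin ℂ (Set.range f) ↔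
      ∀ g ∈ G, ∀ v, MvPolynomial.eval (g v) p = MvPolynomial.eval v p

/-- A vector is regular if it lies on no reflecting hyperplane. -/
def IsRegularVector (G : Subgroup ((Fin l → ℂ) ≃ₗ[ℂ] (Fin l → ℂ))) (v : Fin l → ℂ) : Prop :=
  ∀ H ∈ hyperplanes G, v ∉ H

/-- `ζ_d = exp(2πi/d)`. -/
def zeta (d : ℕ) : ℂ := Complex.exp (2 * Real.pi * Complex.I / d)

/-- `d` is a regular number: some `ζ_d`-eigenspace of an element of `G` contains a regular
vector. -/
def IsRegularNumber (G : Subgroup ((Fin l → ℂ) ≃ₗ[ℂ] (Fin l → ℂ))) (d : ℕ) : Prop :=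
  0 < d ∧ ∃ g ∈ G, ∃ v ∈ eigenspace g (zeta d), IsRegularVector G v

/-- The set `𝒫` of regular numbers `d` which are equal to the greatest common divisor of the
invariant degrees divisible by `d`. -/
def regularPoset (G : Subgroup ((Fin l → ℂ) ≃ₗ[ℂ] (Fin l → ℂ))) (deg : Fin l → ℕ) : Set ℕ :=
  {d | IsRegularNumber G d ∧ d = (Finset.univ.filter fun i => d ∣ deg i).gcd deg}

/-- `E` is a maximal `ζ`-eigenspace: maximal for inclusion among the `V(g, ζ)`, `g ∈ G`. -/
def IsMaximalEigenspace (G : Subgroup ((Fin l → ℂ) ≃ₗ[ℂ] (Fin l → ℂ))) (ζ : ℂ)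
    (E : Submodule ℂ (Fin l → ℂ)) : Prop :=
  Maximal (fun E' => ∃ g ∈ G, E' = eigenspace g ζ) E

/-- `V(d)`, the union of all `ζ_d`-eigenspaces of elements of `G`. -/
def eigenUnion (G : Subgroup ((Fin l → ℂ) ≃ₗ[ℂ] (Fin l → ℂ))) (d : ℕ) : Set (Fin l → ℂ) :=
  ⋃ g ∈ G, (eigenspace g (zeta d) : Set (Fin l → ℂ))

/-- `F(d)° = F(d) \ ⋃_{e ∈ 𝒫, d ∣ e, e ≠ d} F(e)`, where `F(d) = F ∩ V(d)`. -/
def openStratum (G : Subgroup ((Fin l → ℂ) ≃ₗ[ℂ] (Fin l → ℂ))) (deg : Fin l → ℕ)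
    (F : Set (Fin l → ℂ)) (d : ℕ) : Set (Fin l → ℂ) :=
  (F ∩ eigenUnion G d) \ ⋃ e ∈ {e | e ∈ regularPoset G deg ∧ d ∣ e ∧ e ≠ d}, F ∩ eigenUnion G e

/-- The constructible subsets of `F ⊆ ℂ^l`: those subsets of `F` which lie in the Boolean algebra
generated by the zero sets of polynomials. -/
def constructibleSubsets (F : Set (Fin l → ℂ)) : Set (Set (Fin l → ℂ)) :=
  {Y | Y ⊆ F ∧ Y ∈ BooleanSubalgebra.closure
    (Set.range fun p : MvPolynomial (Fin l) ℂ => {v | MvPolynomial.eval v p = 0})}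

/-! ### The group `Γ = G × μ_m` -/

/-- `Γ = G × μ_m` -/
abbrev Gam (G : Subgroup ((Fin l → ℂ) ≃ₗ[ℂ] (Fin l → ℂ))) (m : ℕ) : Type :=
  G × rootsOfUnity m ℂ

/-- `Γ` acts on `V` by `(g, ξ) v = ξ⁻¹ g v`. -/
instance gamMulAction (G : Subgroup ((Fin l → ℂ) ≃ₗ[ℂ] (Fin l → ℂ))) (m : ℕ) :
    MulAction (Gam G m) (Fin l → ℂ) where
  smul γ v := (((γ.2⁻¹ : rootsOfUnity m ℂ) : ℂˣ) : ℂ) • (γ.1 : (Fin l → ℂ) ≃ₗ[ℂ] (Fin l → ℂ)) v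
  one_smul v := by
    change ((((1 : rootsOfUnity m ℂ)⁻¹ : rootsOfUnity m ℂ) : ℂˣ) : ℂ) • v = v
    simp
  mul_smul γ δ v := by
    change ((((γ.2 * δ.2)⁻¹ : rootsOfUnity m ℂ) : ℂˣ) : ℂ) •
        ((γ.1 : (Fin l → ℂ) ≃ₗ[ℂ] (Fin l → ℂ)) ((δ.1 : (Fin l → ℂ) ≃ₗ[ℂ] (Fin l → ℂ)) v)) =
      (((γ.2⁻¹ : rootsOfUnity m ℂ) : ℂˣ) : ℂ) • (γ.1 : (Fin l → ℂ) ≃ₗ[ℂ] (Fin l → ℂ))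
        ((((δ.2⁻¹ : rootsOfUnity m ℂ) : ℂˣ) : ℂ) • (δ.1 : (Fin l → ℂ) ≃ₗ[ℂ] (Fin l → ℂ)) v)
    rw [map_smul, smul_smul]
    simp [mul_comm]

/-- `Γ(d) = G(d) × μ_m`, where `G(d)` is the centraliser of `g_d` in `G`. -/
def gamCentralizer {G : Subgroup ((Fin l → ℂ) ≃ₗ[ℂ] (Fin l → ℂ))} (m : ℕ) (g : G) :
    Subgroup (Gam G m) :=
  (Subgroup.centralizer {g}).prod ⊤

end MilnorDecomp

end

open MilnorDecomp

namespace MilnorDecomp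

open MvPolynomial

variable {l : ℕ}

/-! ### Linear substitutions and directional derivatives of polynomials -/

/-! The basic invariants f = (f_1, …, f_l) identify V/G with affine space: they separate orbits
(`exists_apply_eq`), and the image of a subspace is closed because polynomials are integral over the
invariants (`exists_mem_eval_eq`). Since f_i(ζ_d v) = ζ_d^{d_i} f_i(v), a vector v lies in some V(g,
ζ_d) exactly when d divides every d_i with f_i(v) ≠ 0. So each v in F carries a single number, the
gcd of these d_i (`orbitGcd`). It is constant on Γ-orbits, belongs to 𝒫, and F(d)° is the set of v
in F where it equals d. Hence the F(d)° with d in 𝒫 partition F.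

Inside a stratum two classical theorems are used. Springer: f maps a maximal E_d onto the coordinate
subspace {y_i = 0 unless d ∣ d_i} (`exists_mem_maximal_eval_eq`), so every G-orbit in F(d)° meets
E_d. Steinberg: regular vectors have trivial stabiliser in G (`eq_one_of_isRegularVector`), so if v
and γv both lie in (F ∩ E_d)°, the G-part of γ commutes with g_d. Thus F is the disjoint union of
the translates of the (F ∩ E_d)° indexed by Γ/Γ(d). Freeness follows likewise: γv = v makes v an
eigenvector of the G-part whose eigenvalue is a power of ζ_d, and Steinberg then identifies that
G-part with the same power of g_d.

The rest is formal (`val_top_eq_finsum`). An element of A ⊗ R(Γ) is known from its traces. At γ, the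
translates moved by γ contribute 0, and those fixed by γ give the sum in Frobenius' formula for an
induced character. -/

@[simp]
theorem eval_linearFormPoly (α : (Fin l → ℂ) →ₗ[ℂ] ℂ) (v : Fin l → ℂ) :
    eval v (linearFormPoly α) = α v := by
  conv_rhs => rw [← Finset.univ_sum_single v, map_sum]
  simp only [linearFormPoly, map_sum, map_mul, eval_C, eval_X]
  refine Finset.sum_congr rfl fun i _ => ?_
  rw [mul_comm, ← smul_eq_mul, ← map_smul, ← Pi.single_smul, smul_eq_mul, mul_one]

/-- The polynomial `p ∘ φ` for a linear map `φ`. -/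
noncomputable def linSubst (φ : (Fin l → ℂ) →ₗ[ℂ] (Fin l → ℂ)) :
    MvPolynomial (Fin l) ℂ →ₐ[ℂ] MvPolynomial (Fin l) ℂ :=
  aeval fun i => linearFormPoly (LinearMap.proj i ∘ₗ φ)

@[simp]
theorem eval_linSubst (φ : (Fin l → ℂ) →ₗ[ℂ] (Fin l → ℂ)) (p : MvPolynomial (Fin l) ℂ)
    (v : Fin l → ℂ) : eval v (linSubst φ p) = eval (φ v) p := by
  induction p using MvPolynomial.induction_on with
  | C a => simp [linSubst]
  | add p q hp hq => simp [hp, hq]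
  | mul_X p i hp =>
    have hX : linSubst φ (X i) = linearFormPoly (LinearMap.proj i ∘ₗ φ) := by simp [linSubst]
    simp [hp, hX]

theorem eval_smul_of_isHomogeneous {p : MvPolynomial (Fin l) ℂ} {n : ℕ} (hp : p.IsHomogeneous n)
    (c : ℂ) (v : Fin l → ℂ) : eval (c • v) p = c ^ n * eval v p := by
  rw [eval_eq, eval_eq, Finset.mul_sum]
  refine Finset.sum_congr rfl fun d hd => ?_
  have hd' : ∑ i, d i = n := by
    have := hp (mem_support_iff.1 hd)
    rwa [Finsupp.weight_apply, Finsupp.sum_fintype _ _ (by simp), Finset.sum_congr rfl] at this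
    simp
  have h : ∏ i ∈ d.support, c ^ d i = c ^ n := by
    rw [← hd', ← Finset.prod_pow_eq_pow_sum]
    exact Finset.prod_subset (Finset.subset_univ _) fun i _ hi => by
      rw [Finsupp.notMem_support_iff.1 hi, pow_zero]
  simp only [Pi.smul_apply, smul_eq_mul, mul_pow, Finset.prod_mul_distrib, h]
  ring

/-- The derivative of `p` at `w` in the direction `u`. -/
noncomputable def dirDeriv (w u : Fin l → ℂ) : MvPolynomial (Fin l) ℂ →ₗ[ℂ] ℂ :=
  ∑ j, u j • ((aeval w).toLinearMap ∘ₗ (pderiv j).toLinearMap)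

theorem dirDeriv_apply (w u : Fin l → ℂ) (p : MvPolynomial (Fin l) ℂ) :
    dirDeriv w u p = ∑ j, u j * eval w (pderiv j p) := by
  simp [dirDeriv, aeval_eq_eval]

@[simp]
theorem dirDeriv_C (w u : Fin l → ℂ) (a : ℂ) : dirDeriv w u (C a) = 0 := by
  simp [dirDeriv_apply]

theorem dirDeriv_mul (w u : Fin l → ℂ) (p q : MvPolynomial (Fin l) ℂ) :
    dirDeriv w u (p * q) = eval w p * dirDeriv w u q + eval w q * dirDeriv w u p := by
  simp only [dirDeriv_apply, Derivation.leibniz, smul_eq_mul, map_add, map_mul, Finset.mul_sum,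
    ← Finset.sum_add_distrib]
  exact Finset.sum_congr rfl fun j _ => by ring

theorem dirDeriv_X (w u : Fin l → ℂ) (i : Fin l) : dirDeriv w u (X i) = u i := by
  simp [dirDeriv_apply, pderiv_X, Pi.single_apply, apply_ite (eval w)]

@[simp]
theorem dirDeriv_linearFormPoly (w u : Fin l → ℂ) (α : (Fin l → ℂ) →ₗ[ℂ] ℂ) :
    dirDeriv w u (linearFormPoly α) = α u := by
  rw [← eval_linearFormPoly α u]
  simp [linearFormPoly, dirDeriv_mul, dirDeriv_X]

theorem dirDeriv_linSubst (φ : (Fin l → ℂ) →ₗ[ℂ] (Fin l → ℂ)) (w u : Fin l → ℂ)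
    (p : MvPolynomial (Fin l) ℂ) :
    dirDeriv w u (linSubst φ p) = dirDeriv (φ w) (φ u) p := by
  induction p using MvPolynomial.induction_on with
  | C a => simp [linSubst]
  | add p q hp hq => simp [hp, hq]
  | mul_X p i hp =>
    have hX : linSubst φ (X i) = linearFormPoly (LinearMap.proj i ∘ₗ φ) := by simp [linSubst]
    rw [map_mul, dirDeriv_mul, dirDeriv_mul, hp, eval_linSubst, hX]
    simp [dirDeriv_X]

/-- A squared factor kills both value and first derivative. When averaging over G, this suppresses
all terms but one. -/
theorem dirDeriv_pow_two_of_eval_eq_zero {w : Fin l → ℂ} {p : MvPolynomial (Fin l) ℂ}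
    (hp : eval w p = 0) (u : Fin l → ℂ) (q : MvPolynomial (Fin l) ℂ) :
    dirDeriv w u (q * p ^ 2) = 0 := by
  simp [dirDeriv_mul, pow_two, hp]

/-! ### Avoidance of finitely many zero sets -/

/-- A subspace is irreducible. Composing with a linear retraction onto W turns the question into one
about nonzero polynomials on all of ℂ^l, whose product is nonzero and hence has a nonzero value. -/
theorem exists_mem_forall_eval_ne_zero {ι : Type*} (W : Submodule ℂ (Fin l → ℂ)) (s : Finset ι)
    (p : ι → MvPolynomial (Fin l) ℂ) (h : ∀ i ∈ s, ∃ w ∈ W, eval w (p i) ≠ 0) :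
    ∃ w ∈ W, ∀ i ∈ s, eval w (p i) ≠ 0 := by
  obtain ⟨π, hπ⟩ := W.subtype.exists_leftInverse_of_injective W.ker_subtype
  have hπ' (w) (hw : w ∈ W) : (W.subtype ∘ₗ π) w = w :=
    congrArg Subtype.val (LinearMap.congr_fun hπ ⟨w, hw⟩)
  have hne : ∏ i ∈ s, linSubst (W.subtype ∘ₗ π) (p i) ≠ 0 := by
    refine Finset.prod_ne_zero_iff.2 fun i hi h0 => ?_
    obtain ⟨w, hw, hw0⟩ := h i hi
    rw [← hπ' w hw, ← eval_linSubst, h0] at hw0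
    exact hw0 (map_zero _)
  obtain ⟨v, hv⟩ : ∃ v, eval v (∏ i ∈ s, linSubst (W.subtype ∘ₗ π) (p i)) ≠ 0 := by
    by_contra! h0
    exact hne (funext fun v => by rw [h0, map_zero])
  rw [map_prod, Finset.prod_ne_zero_iff] at hv
  exact ⟨(W.subtype ∘ₗ π) v, (π v).2, fun i hi => by simpa using hv i hi⟩

theorem exists_dual_of_notMem {W : Submodule ℂ (Fin l → ℂ)} {w : Fin l → ℂ} (hw : w ∉ W) :
    ∃ α : (Fin l → ℂ) →ₗ[ℂ] ℂ, α w ≠ 0 ∧ ∀ u ∈ W, α u = 0 := by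
  obtain ⟨α, h1, h2⟩ := Submodule.exists_le_ker_of_notMem hw
  exact ⟨α, h1, fun u hu => h2 hu⟩

theorem exists_mem_forall_notMem {ι : Type*} (W : Submodule ℂ (Fin l → ℂ)) (s : Finset ι)
    (U : ι → Submodule ℂ (Fin l → ℂ)) (h : ∀ i ∈ s, ¬ W ≤ U i) :
    ∃ w ∈ W, ∀ i ∈ s, w ∉ U i := by
  have h' (i) : ∃ α : (Fin l → ℂ) →ₗ[ℂ] ℂ, i ∈ s → (∃ w ∈ W, α w ≠ 0) ∧ ∀ u ∈ U i, α u = 0 := by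
    by_cases hi : i ∈ s
    · obtain ⟨w, hw, hwU⟩ := SetLike.not_le_iff_exists.1 (h i hi)
      obtain ⟨α, h1, h2⟩ := exists_dual_of_notMem hwU
      exact ⟨α, fun _ => ⟨⟨w, hw, h1⟩, h2⟩⟩
    · exact ⟨0, fun h => absurd h hi⟩
  choose α hα using h'
  obtain ⟨w, hw, hw'⟩ := exists_mem_forall_eval_ne_zero W s (fun i => linearFormPoly (α i))
    fun i hi => by simpa using (hα i hi).1
  exact ⟨w, hw, fun i hi hU => hw' i hi (by simpa using (hα i hi).2 w hU)⟩

theorem exists_dual_forall_ne_zero {ι : Type*} (s : Finset ι) (u : ι → Fin l → ℂ)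
    (h : ∀ i ∈ s, u i ≠ 0) : ∃ α : (Fin l → ℂ) →ₗ[ℂ] ℂ, ∀ i ∈ s, α (u i) ≠ 0 := by
  obtain ⟨α, hα⟩ := Module.exists_dual_forall_apply_ne_zero (K := ℂ) (fun i : s => u i)
    fun i => h i i.2
  exact ⟨α, fun i hi => hα ⟨i, hi⟩⟩

end MilnorDecomp

namespace MilnorDecomp

open MvPolynomial

variable {l : ℕ}

theorem eval_aeval_apply (f : Fin l → MvPolynomial (Fin l) ℂ) (w : Fin l → ℂ)
    (P : MvPolynomial (Fin l) ℂ) : eval w (aeval f P) = eval (fun i => eval w (f i)) P := by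
  induction P using MvPolynomial.induction_on with
  | C a => simp
  | add p q hp hq => simp only [map_add, hp, hq]
  | mul_X p i hp => simp only [map_mul, hp, aeval_X, eval_X]

/-! ### Basic invariants -/

/-- `f` is a system of basic invariants of `G` of degrees `deg`. -/
structure IsBasicInvariants (G : Subgroup ((Fin l → ℂ) ≃ₗ[ℂ] (Fin l → ℂ))) (deg : Fin l → ℕ)
    (f : Fin l → MvPolynomial (Fin l) ℂ) : Prop where
  isHomogeneous : ∀ i, (f i).IsHomogeneous (deg i)
  algebraicIndependent : AlgebraicIndependent ℂ f
  mem_adjoin_iff : ∀ p : MvPolynomial (Fin l) ℂ, p ∈ Algebra.adjoin ℂ (Set.range f) ↔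
      ∀ g ∈ G, ∀ v, eval (g v) p = eval v p

variable {G : Subgroup ((Fin l → ℂ) ≃ₗ[ℂ] (Fin l → ℂ))} {deg : Fin l → ℕ}
  {f : Fin l → MvPolynomial (Fin l) ℂ}

theorem mem_eigenspace {g : (Fin l → ℂ) ≃ₗ[ℂ] (Fin l → ℂ)} {c : ℂ} {v : Fin l → ℂ} :
    v ∈ eigenspace g c ↔ g v = c • v :=
  Module.End.mem_eigenspace_iff

theorem comap_eigenspace (g r : (Fin l → ℂ) ≃ₗ[ℂ] (Fin l → ℂ)) (c : ℂ) :
    (eigenspace r c).comap (g : (Fin l → ℂ) →ₗ[ℂ] (Fin l → ℂ)) =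
      eigenspace (g⁻¹ * r * g) c := by
  ext v
  simp only [Submodule.mem_comap, mem_eigenspace, LinearEquiv.mul_apply, LinearEquiv.coe_coe]
  rw [← map_smul]
  exact (LinearEquiv.symm_apply_eq g).symm

theorem mem_eigenUnion {d : ℕ} {v : Fin l → ℂ} :
    v ∈ eigenUnion G d ↔ ∃ g ∈ G, g v = zeta d • v := by
  simp [eigenUnion, mem_eigenspace]

theorem isPrimitiveRoot_zeta {d : ℕ} (hd : d ≠ 0) : IsPrimitiveRoot (zeta d) d :=
  Complex.isPrimitiveRoot_exp d hd

namespace IsBasicInvariants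

theorem eval_apply (hf : IsBasicInvariants G deg f) {g : (Fin l → ℂ) ≃ₗ[ℂ] (Fin l → ℂ)}
    (hg : g ∈ G) (v : Fin l → ℂ) (i : Fin l) : eval (g v) (f i) = eval v (f i) :=
  (hf.mem_adjoin_iff (f i)).1 (Algebra.subset_adjoin ⟨i, rfl⟩) g hg v

theorem eval_smul (hf : IsBasicInvariants G deg f) (c : ℂ) (v : Fin l → ℂ) (i : Fin l) :
    eval (c • v) (f i) = c ^ deg i * eval v (f i) :=
  eval_smul_of_isHomogeneous (hf.isHomogeneous i) c v

/-- An invariant of degree 0 would be a constant, hence algebraic over ℂ. -/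
theorem deg_ne_zero (hf : IsBasicInvariants G deg f) (i : Fin l) : deg i ≠ 0 := by
  intro h
  have h1 := totalDegree_eq_zero_iff_eq_C.1 (Nat.le_zero.1 (h ▸ (hf.isHomogeneous i).totalDegree_le))
  have h2 := hf.algebraicIndependent.transcendental i
  rw [h1] at h2
  exact h2 (isAlgebraic_algebraMap _)

theorem eval_zero (hf : IsBasicInvariants G deg f) (i : Fin l) : eval 0 (f i) = 0 := by
  simpa [hf.deg_ne_zero i] using hf.eval_smul 0 0 i

theorem eval_eq_of_forall {v w : Fin l → ℂ} (h : ∀ i, eval v (f i) = eval w (f i))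
    {p : MvPolynomial (Fin l) ℂ} (hp : p ∈ Algebra.adjoin ℂ (Set.range f)) :
    eval v p = eval w p := by
  induction hp using Algebra.adjoin_induction with
  | mem x hx => obtain ⟨i, rfl⟩ := hx; exact h i
  | algebraMap r => simp [algebraMap_eq]
  | add x y _ _ hx hy => simp [hx, hy]
  | mul x y _ _ hx hy => simp [hx, hy]

/-- The basic invariants separate the orbits of `G`. -/
theorem exists_apply_eq [Finite G] (hf : IsBasicInvariants G deg f) {v w : Fin l → ℂ}
    (h : ∀ i, eval v (f i) = eval w (f i)) : ∃ g ∈ G, g v = w := by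
  have := Fintype.ofFinite G
  by_contra! hne
  obtain ⟨α, hα⟩ := exists_dual_forall_ne_zero (Finset.univ : Finset G)
    (fun g => (g : (Fin l → ℂ) ≃ₗ[ℂ] (Fin l → ℂ)) v - w) fun g _ => sub_ne_zero.2 (hne g g.2)
  -- This invariant, u ↦ ∏ α(gu − w), vanishes at w through the factor g = 1, but not at v by the
  -- choice of α.
  let p : MvPolynomial (Fin l) ℂ := ∏ g : G,
    linSubst ((g : (Fin l → ℂ) ≃ₗ[ℂ] (Fin l → ℂ)) : (Fin l → ℂ) →ₗ[ℂ] (Fin l → ℂ))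
      (linearFormPoly α - C (α w))
  have hp (u) : eval u p = ∏ g : G, α ((g : (Fin l → ℂ) ≃ₗ[ℂ] (Fin l → ℂ)) u - w) := by
    simp [p, map_prod]
  have hpm : p ∈ Algebra.adjoin ℂ (Set.range f) := by
    rw [hf.mem_adjoin_iff]
    intro g hg u
    rw [hp, hp]
    exact Fintype.prod_equiv (Equiv.mulRight (⟨g, hg⟩ : G)) _ _ fun x => rfl
  have h1 := eval_eq_of_forall h hpm
  rw [hp, hp, Finset.prod_eq_zero (f := fun g : G =>
    α ((g : (Fin l → ℂ) ≃ₗ[ℂ] (Fin l → ℂ)) w - w)) (Finset.mem_univ (1 : G)) (by simp)] at h1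
  exact Finset.prod_ne_zero_iff.2 hα h1

/-- The polynomial ring is integral over the algebra generated by the basic invariants. -/
theorem isIntegral_aeval [Finite G] (hf : IsBasicInvariants G deg f) :
    (aeval (R := ℂ) f : MvPolynomial (Fin l) ℂ →ₐ[ℂ] MvPolynomial (Fin l) ℂ).toRingHom.IsIntegral := by
  have := Fintype.ofFinite G
  intro p
  -- This monic polynomial has p as a root, and G permutes its factors, so its coefficients are
  -- invariant.
  let P : Polynomial (MvPolynomial (Fin l) ℂ) := ∏ g : G, (Polynomial.X - Polynomial.C
    (linSubst ((g : (Fin l → ℂ) ≃ₗ[ℂ] (Fin l → ℂ)) : (Fin l → ℂ) →ₗ[ℂ] (Fin l → ℂ)) p))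
  have hPm : P.Monic := Polynomial.monic_prod_of_monic _ _ fun g _ => Polynomial.monic_X_sub_C _
  have hmap (v) : P.map (eval v) = ∏ g : G, (Polynomial.X - Polynomial.C
      (eval ((g : (Fin l → ℂ) ≃ₗ[ℂ] (Fin l → ℂ)) v) p)) := by
    simp [P, Polynomial.map_prod]
  have hlift : P ∈ Polynomial.lifts
      (aeval (R := ℂ) f : MvPolynomial (Fin l) ℂ →ₐ[ℂ] MvPolynomial (Fin l) ℂ).toRingHom := by
    rw [Polynomial.lifts_iff_coeff_lifts]
    intro n
    have hn : P.coeff n ∈ Algebra.adjoin ℂ (Set.range f) := by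
      rw [hf.mem_adjoin_iff]
      intro g hg v
      rw [← Polynomial.coeff_map, ← Polynomial.coeff_map, hmap, hmap]
      congr 1
      exact Fintype.prod_equiv (Equiv.mulRight (⟨g, hg⟩ : G)) _ _ fun x => rfl
    rw [Algebra.adjoin_range_eq_range_aeval] at hn
    exact hn
  obtain ⟨q, hq, -, hqm⟩ := Polynomial.lifts_and_natDegree_eq_and_monic hlift hPm
  refine ⟨q, hqm, ?_⟩
  rw [Polynomial.eval₂_eq_eval_map, hq, Polynomial.eval_prod]
  refine Finset.prod_eq_zero (Finset.mem_univ (1 : G)) ?_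
  have h1 : linSubst (((1 : G) : (Fin l → ℂ) ≃ₗ[ℂ] (Fin l → ℂ)) : (Fin l → ℂ) →ₗ[ℂ] (Fin l → ℂ)) p
      = p := MvPolynomial.funext fun v => by simp
  rw [h1]
  simp

/-- The image of a subspace under the quotient map `V → V / G` is closed. -/
theorem exists_mem_eval_eq [Finite G] (hf : IsBasicInvariants G deg f)
    (W : Submodule ℂ (Fin l → ℂ)) (y : Fin l → ℂ)
    (h : ∀ P : MvPolynomial (Fin l) ℂ, (∀ w ∈ W, eval (fun i => eval w (f i)) P = 0) →
      eval y P = 0) :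
    ∃ w ∈ W, ∀ i, eval w (f i) = y i := by
  -- The coordinate ring of W is integral over ℂ[y_1, …, y_l] through f. Lying-over, applicable
  -- because the hypothesis puts the kernel inside the maximal ideal of y, gives a maximal ideal
  -- above it, which by the Nullstellensatz is a point w.
  let I : Ideal (MvPolynomial (Fin l) ℂ) := vanishingIdeal ℂ (W : Set (Fin l → ℂ))
  let φ : MvPolynomial (Fin l) ℂ →+* MvPolynomial (Fin l) ℂ ⧸ I :=
    (Ideal.Quotient.mk I).comp
      (aeval (R := ℂ) f : MvPolynomial (Fin l) ℂ →ₐ[ℂ] MvPolynomial (Fin l) ℂ).toRingHom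
  have hφ : φ.IsIntegral := hf.isIntegral_aeval.trans _ _
    (RingHom.isIntegral_of_surjective _ Ideal.Quotient.mk_surjective)
  let := φ.toAlgebra
  have : Algebra.IsIntegral (MvPolynomial (Fin l) ℂ) (MvPolynomial (Fin l) ℂ ⧸ I) := ⟨hφ⟩
  obtain ⟨Q, hQm, hQ⟩ := Ideal.exists_ideal_over_maximal_of_isIntegral
    (S := MvPolynomial (Fin l) ℂ ⧸ I) (vanishingIdeal ℂ {y} : Ideal (MvPolynomial (Fin l) ℂ)) (by
      intro P hP
      rw [mem_vanishingIdeal_singleton_iff]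
      refine h P fun w hw => ?_
      rw [← eval_aeval_apply]
      exact (Ideal.Quotient.eq_zero_iff_mem.1 hP) w hw)
  have := Ideal.comap_isMaximal_of_surjective (Ideal.Quotient.mk I) Ideal.Quotient.mk_surjective
    (K := Q)
  obtain ⟨w, hw⟩ := isMaximal_iff_eq_vanishingIdeal_singleton.1 this
  refine ⟨w, ?_, fun i => ?_⟩
  -- Linear forms vanishing on W are zero in the quotient, so they belong to the maximal ideal of w.
  · by_contra hwW
    obtain ⟨α, h1, h2⟩ := exists_dual_of_notMem hwW
    have h3 : linearFormPoly α ∈ Q.comap (Ideal.Quotient.mk I) := by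
      have : Ideal.Quotient.mk I (linearFormPoly α) = 0 :=
        Ideal.Quotient.eq_zero_iff_mem.2 fun u hu => by
          simpa [aeval_eq_eval] using h2 u hu
      rw [Ideal.mem_comap, this]
      exact zero_mem _
    rw [hw, mem_vanishingIdeal_singleton_iff] at h3
    exact h1 (by simpa [aeval_eq_eval] using h3)
  · have h1 : (X i - C (y i) : MvPolynomial (Fin l) ℂ) ∈
        Q.comap (algebraMap (MvPolynomial (Fin l) ℂ) (MvPolynomial (Fin l) ℂ ⧸ I)) := by
      rw [hQ, mem_vanishingIdeal_singleton_iff]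
      simp
    have h2 : (f i - C (y i)) ∈ Q.comap (Ideal.Quotient.mk I) := by
      have h3 : φ (X i - C (y i)) ∈ Q := h1
      simpa [φ] using h3
    rw [hw, mem_vanishingIdeal_singleton_iff] at h2
    simpa [aeval_eq_eval, sub_eq_zero] using h2

/-- The image of V is closed, and by algebraic independence no nonzero polynomial vanishes on it. -/
theorem exists_eval_eq [Finite G] (hf : IsBasicInvariants G deg f) (y : Fin l → ℂ) :
    ∃ w, ∀ i, eval w (f i) = y i := by
  obtain ⟨w, -, hw⟩ := hf.exists_mem_eval_eq ⊤ y fun P hP => by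
    have : aeval (R := ℂ) f P = 0 := MvPolynomial.funext fun w => by
      rw [map_zero, eval_aeval_apply, hP w trivial]
    rw [hf.algebraicIndependent.eq_zero_of_aeval_eq_zero P this, map_zero]
  exact ⟨w, hw⟩

/-! ### Eigenspaces -/

theorem pow_deg_eq_one (hf : IsBasicInvariants G deg f) {g : (Fin l → ℂ) ≃ₗ[ℂ] (Fin l → ℂ)}
    (hg : g ∈ G) {c : ℂ} {v : Fin l → ℂ} (hv : g v = c • v) {i : Fin l}
    (hi : eval v (f i) ≠ 0) : c ^ deg i = 1 := by
  have h := hf.eval_apply hg v i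
  rw [hv, hf.eval_smul] at h
  exact mul_right_cancel₀ hi (h.trans (one_mul _).symm)

theorem mem_eigenUnion_iff [Finite G] (hf : IsBasicInvariants G deg f) {d : ℕ} (hd : d ≠ 0)
    {v : Fin l → ℂ} : v ∈ eigenUnion G d ↔ ∀ i, eval v (f i) ≠ 0 → d ∣ deg i := by
  simp only [mem_eigenUnion]
  constructor
  · rintro ⟨g, hg, hv⟩ i hi
    exact (isPrimitiveRoot_zeta hd).dvd_of_pow_eq_one _ (hf.pow_deg_eq_one hg hv hi)
  · intro h
    refine hf.exists_apply_eq fun i => ?_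
    rw [hf.eval_smul]
    by_cases hi : eval v (f i) = 0
    · simp [hi]
    · obtain ⟨k, hk⟩ := h i hi
      rw [hk, pow_mul, (isPrimitiveRoot_zeta hd).pow_eq_one, one_pow, one_mul]

/-- The coordinate subspace {y_i = 0 unless d ∣ d_i} is the union of the finitely many closed images
of the V(h, ζ_d). Being irreducible, it is one of these images. -/
theorem exists_eigenspace_surjective [Finite G] (hf : IsBasicInvariants G deg f) {d : ℕ}
    (hd : d ≠ 0) : ∃ h ∈ G, ∀ y : Fin l → ℂ, (∀ i, y i ≠ 0 → d ∣ deg i) →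
      ∃ v ∈ eigenspace h (zeta d), ∀ i, eval v (f i) = y i := by
  have := Fintype.ofFinite G
  by_contra! hne
  have hne' (h : G) : ∃ y : Fin l → ℂ, (∀ i, y i ≠ 0 → d ∣ deg i) ∧
      ∃ P : MvPolynomial (Fin l) ℂ,
        (∀ w ∈ eigenspace h.1 (zeta d), eval (fun i => eval w (f i)) P = 0) ∧ eval y P ≠ 0 := by
    obtain ⟨y, hy, hy'⟩ := hne h h.2
    refine ⟨y, hy, ?_⟩
    by_contra! hP
    obtain ⟨w, hw, hw'⟩ := hf.exists_mem_eval_eq _ y hP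
    obtain ⟨i, hi⟩ := hy' w hw
    exact hi (hw' i)
  choose y hy P hP hPy using hne'
  -- Substituting 0 for the variables with d ∤ deg i restricts each `P h` to the coordinate
  -- subspace. A point there at which no `P h` vanishes lifts to an eigenvector of some h, a
  -- contradiction.
  obtain ⟨z, -, hz⟩ := exists_mem_forall_eval_ne_zero ⊤ (Finset.univ : Finset G)
    (fun h => aeval (R := ℂ) (fun i => if d ∣ deg i then X i else 0) (P h)) fun h _ => by
      refine ⟨y h, trivial, ?_⟩
      rw [eval_aeval_apply]
      convert! hPy h using 3
      funext i
      split_ifs with hi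
      · simp
      · simpa using (not_imp_comm.1 (hy h i) hi).symm
  obtain ⟨v, hv⟩ := hf.exists_eval_eq fun i => if d ∣ deg i then z i else 0
  have hvd : v ∈ eigenUnion G d := by
    rw [hf.mem_eigenUnion_iff hd]
    intro i hi
    by_contra h
    exact hi (by rw [hv, if_neg h])
  obtain ⟨h, hh, hvh⟩ := mem_eigenUnion.1 hvd
  refine hz ⟨h, hh⟩ (Finset.mem_univ _) ?_
  rw [eval_aeval_apply]
  convert! hP ⟨h, hh⟩ v (mem_eigenspace.2 hvh) using 3
  funext i
  rw [hv]
  split_ifs <;> simp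

/-- The basic invariants of degree divisible by `d` map a maximal `ζ_d`-eigenspace onto
an affine space. -/
theorem exists_mem_maximal_eval_eq [Finite G] (hf : IsBasicInvariants G deg f) {d : ℕ}
    (hd : d ≠ 0) {E : Submodule ℂ (Fin l → ℂ)} (hE : IsMaximalEigenspace G (zeta d) E)
    {y : Fin l → ℂ} (hy : ∀ i, y i ≠ 0 → d ∣ deg i) :
    ∃ v ∈ E, ∀ i, eval v (f i) = y i := by
  have := Fintype.ofFinite G
  obtain ⟨h, hh, hsurj⟩ := hf.exists_eigenspace_surjective hd
  obtain ⟨⟨g, hg, rfl⟩, hmax⟩ := hE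
  -- Every orbit meeting V(g, ζ_d) meets V(h, ζ_d), so V(g, ζ_d) is covered by finitely many
  -- translates of V(h, ζ_d) and lies in one of them; maximality then forces equality.
  obtain ⟨x, hx⟩ : ∃ x : G, eigenspace g (zeta d) ≤ (eigenspace h (zeta d)).comap
      ((x : (Fin l → ℂ) ≃ₗ[ℂ] (Fin l → ℂ)) : (Fin l → ℂ) →ₗ[ℂ] (Fin l → ℂ)) := by
    by_contra! hne
    obtain ⟨w, hw, hw'⟩ := exists_mem_forall_notMem _ (Finset.univ : Finset G) _
      fun x _ => hne x
    obtain ⟨v, hv, hv'⟩ := hsurj (fun i => eval w (f i)) ((hf.mem_eigenUnion_iff hd).1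
      (mem_eigenUnion.2 ⟨g, hg, mem_eigenspace.1 hw⟩))
    obtain ⟨x, hx, hxw⟩ := hf.exists_apply_eq fun i => (hv' i).symm
    exact hw' ⟨x, hx⟩ (Finset.mem_univ _) (by simpa [hxw] using hv)
  have hle := hmax ⟨_, G.mul_mem (G.mul_mem (G.inv_mem x.2) hh) x.2, comap_eigenspace x.1 h _⟩ hx
  obtain ⟨v, hv, hv'⟩ := hsurj y hy
  refine ⟨x.1.symm v, hle (by simpa using hv), fun i => ?_⟩
  rw [← hv', ← hf.eval_apply x.2, LinearEquiv.apply_symm_apply]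

end IsBasicInvariants

end MilnorDecomp

namespace MilnorDecomp

open MvPolynomial

variable {l : ℕ} {G : Subgroup ((Fin l → ℂ) ≃ₗ[ℂ] (Fin l → ℂ))} {deg : Fin l → ℕ}
  {f : Fin l → MvPolynomial (Fin l) ℂ}

/-! ### The Jacobian of the basic invariants and Steinberg's theorem -/

/-- The Jacobian determinant of `f`. -/
noncomputable def jacobian (f : Fin l → MvPolynomial (Fin l) ℂ) : MvPolynomial (Fin l) ℂ :=
  (Matrix.of fun i j => pderiv j (f i)).det

theorem eval_jacobian_ne_zero_iff (w : Fin l → ℂ) :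
    eval w (jacobian f) ≠ 0 ↔ ∀ u, (∀ i, dirDeriv w u (f i) = 0) → u = 0 := by
  have h (u : Fin l → ℂ) : (∀ i, dirDeriv w u (f i) = 0) ↔
      ((eval w).mapMatrix (Matrix.of fun i j => pderiv j (f i))).mulVec u = 0 := by
    simp [_root_.funext_iff, Matrix.mulVec, dotProduct, dirDeriv_apply, mul_comm]
  rw [jacobian, RingHom.map_det, Ne, ← Matrix.exists_mulVec_eq_zero_iff]
  simp only [h]
  push Not
  exact forall_congr' fun u => not_imp_not

theorem dirDeriv_sub_right (w u u' : Fin l → ℂ) (p : MvPolynomial (Fin l) ℂ) :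
    dirDeriv w (u - u') p = dirDeriv w u p - dirDeriv w u' p := by
  simp [dirDeriv_apply, sub_mul]

namespace IsBasicInvariants

/-- Differentiating f_i ∘ g = f_i at the fixed point w shows that every gu − u is killed by all the
differentials of the f_i at w. -/
theorem eq_one_of_eval_jacobian_ne_zero (hf : IsBasicInvariants G deg f) {w : Fin l → ℂ}
    (hw : eval w (jacobian f) ≠ 0) {g : (Fin l → ℂ) ≃ₗ[ℂ] (Fin l → ℂ)} (hg : g ∈ G)
    (hgw : g w = w) : g = 1 := by
  ext1 u
  refine sub_eq_zero.1 ((eval_jacobian_ne_zero_iff w).1 hw (g u - u) fun i => ?_)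
  have h : linSubst (g : (Fin l → ℂ) →ₗ[ℂ] (Fin l → ℂ)) (f i) = f i :=
    MvPolynomial.funext fun v => by simpa using hf.eval_apply hg v i
  have h2 := dirDeriv_linSubst (g : (Fin l → ℂ) →ₗ[ℂ] (Fin l → ℂ)) w u (f i)
  rw [h, LinearEquiv.coe_coe, hgw] at h2
  rw [dirDeriv_sub_right, h2, sub_self]

/-- If all df_i(u) = 0 at w, then every invariant has zero derivative at w along u. For u ≠ 0,
averaging a polynomial concentrated at the point w of its free orbit gives an invariant violating
this. -/
theorem eval_jacobian_ne_zero [Finite G] (hf : IsBasicInvariants G deg f) {w : Fin l → ℂ}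
    (hw : ∀ g ∈ G, g w = w → g = 1) : eval w (jacobian f) ≠ 0 := by
  classical
  have := Fintype.ofFinite G
  rw [eval_jacobian_ne_zero_iff]
  intro u hu
  have hD (p) (hp : p ∈ Algebra.adjoin ℂ (Set.range f)) : dirDeriv w u p = 0 := by
    induction hp using Algebra.adjoin_induction with
    | mem x hx => obtain ⟨i, rfl⟩ := hx; exact hu i
    | algebraMap r => simp [algebraMap_eq]
    | add x y _ _ hx hy => simp [hx, hy]
    | mul x y _ _ hx hy => simp [dirDeriv_mul, hx, hy]
  by_contra hu0
  obtain ⟨α, hα⟩ := exists_dual_forall_ne_zero ({()} : Finset Unit) (fun _ => u) fun _ _ => hu0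
  obtain ⟨lam, hlam⟩ := exists_dual_forall_ne_zero ((Finset.univ : Finset G).erase 1)
    (fun g => w - (g : (Fin l → ℂ) ≃ₗ[ℂ] (Fin l → ℂ)) w) fun g hg h =>
      (Finset.mem_erase.1 hg).1 (Subtype.ext (hw g g.2 (sub_eq_zero.1 h).symm))
  -- `R` vanishes at the other orbit points gw and not at w, so in the average of `q` only the term
  -- g = 1 contributes to the derivative at w, namely R(w)² α(u).
  let R : MvPolynomial (Fin l) ℂ := ∏ g ∈ (Finset.univ : Finset G).erase 1,
    (linearFormPoly lam - C (lam ((g : (Fin l → ℂ) ≃ₗ[ℂ] (Fin l → ℂ)) w)))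
  let q : MvPolynomial (Fin l) ℂ := (linearFormPoly α - C (α w)) * R ^ 2
  let p : MvPolynomial (Fin l) ℂ := ∑ g : G,
    linSubst ((g : (Fin l → ℂ) ≃ₗ[ℂ] (Fin l → ℂ)) : (Fin l → ℂ) →ₗ[ℂ] (Fin l → ℂ)) q
  have hp : p ∈ Algebra.adjoin ℂ (Set.range f) := by
    rw [hf.mem_adjoin_iff]
    intro g hg v
    simp only [p, map_sum, eval_linSubst]
    exact Fintype.sum_equiv (Equiv.mulRight (⟨g, hg⟩ : G)) _ _ fun x => rfl
  have h := hD p hp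
  simp only [p, map_sum, dirDeriv_linSubst] at h
  rw [Finset.sum_eq_single (1 : G)] at h
  · simp [q, dirDeriv_mul] at h
    rcases h with h | h
    · rw [map_prod, Finset.prod_eq_zero_iff] at h
      obtain ⟨g, hg, h⟩ := h
      exact hlam g hg (by simpa using h)
    · exact hα () (by simp) h
  · intro g _ hg
    refine dirDeriv_pow_two_of_eval_eq_zero ?_ _ _
    rw [map_prod]
    exact Finset.prod_eq_zero (Finset.mem_erase.2 ⟨hg, Finset.mem_univ g⟩) (by simp)
  · simp

end IsBasicInvariants

theorem linearFormPoly_isHomogeneous (α : (Fin l → ℂ) →ₗ[ℂ] ℂ) :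
    (linearFormPoly α).IsHomogeneous 1 :=
  IsHomogeneous.sum _ _ _ fun i _ => by
    simpa using (isHomogeneous_C (Fin l) (α (Pi.single i 1))).mul (isHomogeneous_X ℂ i)

/-- A prime factor of a nonzero linear form is proportional to it. -/
theorem eval_eq_zero_of_dvd_linearFormPoly {α : (Fin l → ℂ) →ₗ[ℂ] ℂ} (hα : α ≠ 0)
    {p : MvPolynomial (Fin l) ℂ} (hp : Prime p) (h : p ∣ linearFormPoly α) (v : Fin l → ℂ) :
    eval v p = 0 ↔ α v = 0 := by
  obtain ⟨c, hc⟩ := h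
  have hα0 : linearFormPoly α ≠ 0 := fun h0 => hα (LinearMap.ext fun v => by
    rw [← eval_linearFormPoly, h0, map_zero, LinearMap.zero_apply])
  have hc0 : c ≠ 0 := by rintro rfl; exact hα0 (by rw [hc, mul_zero])
  have hdeg := totalDegree_mul_of_isDomain hp.ne_zero hc0
  rw [← hc, (linearFormPoly_isHomogeneous α).totalDegree hα0] at hdeg
  have hpd : p.totalDegree ≠ 0 := fun h0 => by
    rw [totalDegree_eq_zero_iff_eq_C] at h0
    refine hp.not_isUnit (h0 ▸ (isUnit_iff_ne_zero.2 fun h1 => hp.ne_zero ?_).map C)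
    rw [h0, h1, C_0]
  have hcd : c.totalDegree = 0 := by omega
  rw [totalDegree_eq_zero_iff_eq_C] at hcd
  rw [← eval_linearFormPoly, hc, hcd, map_mul, eval_C, mul_eq_zero, or_iff_left]
  intro h1
  exact hc0 (by rw [hcd, h1, C_0])

theorem isReflection_of_ker_le {g : (Fin l → ℂ) ≃ₗ[ℂ] (Fin l → ℂ)} (hg : g ≠ 1)
    {α : (Fin l → ℂ) →ₗ[ℂ] ℂ} (h : LinearMap.ker α ≤ eigenspace g 1) :
    IsReflection g := by
  have htop : eigenspace g 1 ≠ ⊤ := fun htop => hg (by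
    ext1 v
    simpa using mem_eigenspace.1 (htop ▸ Submodule.mem_top : v ∈ eigenspace g 1))
  have h1 := Submodule.finrank_lt htop
  have h2 := Submodule.finrank_mono h
  have h3 := LinearMap.finrank_range_add_finrank_ker α
  have h4 := Submodule.finrank_le (LinearMap.range α)
  rw [Module.finrank_self] at h4
  rw [Module.finrank_fin_fun] at h1 h3
  unfold IsReflection
  omega

namespace IsBasicInvariants

/-- Steinberg's theorem: a regular vector has trivial stabiliser. -/
theorem eq_one_of_isRegularVector [Finite G] (hf : IsBasicInvariants G deg f) {w : Fin l → ℂ}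
    (hw : IsRegularVector G w) {g : (Fin l → ℂ) ≃ₗ[ℂ] (Fin l → ℂ)} (hg : g ∈ G)
    (hgw : g w = w) : g = 1 := by
  classical
  have := Fintype.ofFinite G
  refine hf.eq_one_of_eval_jacobian_ne_zero (fun hJw => ?_) hg hgw
  have hfix (v : Fin l → ℂ) (hv : eval v (jacobian f) = 0) :
      ∃ g : G, g ≠ 1 ∧ v ∈ eigenspace g.1 1 := by
    by_contra! h
    refine hf.eval_jacobian_ne_zero (fun g hg hgv => ?_) hv
    by_contra hg1
    exact h ⟨g, hg⟩ (fun h => hg1 (congrArg Subtype.val h)) (mem_eigenspace.2 (by simpa using hgv))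
  have hJ0 : jacobian f ≠ 0 := by
    obtain ⟨v, -, hv⟩ := exists_mem_forall_notMem ⊤ ((Finset.univ : Finset G).erase 1)
      (fun g => eigenspace g.1 1) fun g hg h => (Finset.mem_erase.1 hg).1 (by
        ext1; ext1 v
        simpa using mem_eigenspace.1 (h (Submodule.mem_top : v ∈ _)))
    intro h0
    obtain ⟨g, hg, hgv⟩ := hfix v (by rw [h0, map_zero])
    exact hv g (by simpa using hg) hgv
  -- The zero set of this prime factor will turn out to be a reflecting hyperplane through w.
  obtain ⟨p, hp, hpJ, hpw⟩ : ∃ p, Prime p ∧ p ∣ jacobian f ∧ eval w p = 0 := by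
    obtain ⟨s, hs, hsJ⟩ := UniqueFactorizationMonoid.exists_prime_factors _ hJ0
    have h0 : eval w s.prod = 0 := by
      have := (hsJ.map (eval w))
      rwa [hJw, associated_zero_iff_eq_zero] at this
    rw [map_multiset_prod, Multiset.prod_eq_zero_iff, Multiset.mem_map] at h0
    obtain ⟨p, hps, hpw⟩ := h0
    exact ⟨p, hs p hps, (Multiset.dvd_prod hps).trans hsJ.dvd, hpw⟩
  have hα (g : G) : ∃ α : (Fin l → ℂ) →ₗ[ℂ] ℂ, g ≠ 1 → α ≠ 0 ∧ ∀ v ∈ eigenspace g.1 1, α v = 0 := by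
    by_cases hg : g = 1
    · exact ⟨0, fun h => absurd hg h⟩
    obtain ⟨v, hv⟩ : ∃ v, v ∉ eigenspace g.1 1 := by
      by_contra! h
      exact hg (by ext1; ext1 v; simpa using mem_eigenspace.1 (h v))
    obtain ⟨α, h1, h2⟩ := exists_dual_of_notMem hv
    exact ⟨α, fun _ => ⟨fun h => h1 (by simp [h]), h2⟩⟩
  choose α hα using hα
  -- Zeros of p are zeros of the Jacobian, so they are fixed by some g ≠ 1 and lie on ker α_g. The
  -- Nullstellensatz turns this inclusion into divisibility of a power of the product.
  have hdvd : p ∣ ∏ g ∈ (Finset.univ : Finset G).erase 1, linearFormPoly (α g) := by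
    have hrad : ∏ g ∈ (Finset.univ : Finset G).erase 1, linearFormPoly (α g) ∈
        vanishingIdeal ℂ (zeroLocus ℂ (Ideal.span {p})) := by
      intro v hv
      obtain ⟨c, hc⟩ := hpJ
      have hpv : eval v p = 0 := by
        simpa [aeval_eq_eval] using hv p (Ideal.mem_span_singleton_self p)
      obtain ⟨g, hg, hgv⟩ := hfix v (by rw [hc, map_mul, hpv, zero_mul])
      rw [aeval_eq_eval, map_prod]
      exact Finset.prod_eq_zero (Finset.mem_erase.2 ⟨hg, Finset.mem_univ g⟩)
        (by simpa using (hα g hg).2 v hgv)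
    rw [vanishingIdeal_zeroLocus_eq_radical] at hrad
    obtain ⟨n, hn⟩ := hrad
    exact hp.dvd_of_dvd_pow (Ideal.mem_span_singleton.1 hn)
  obtain ⟨g, hg, hpg⟩ := hp.exists_mem_finset_dvd hdvd
  have hker (v) := eval_eq_zero_of_dvd_linearFormPoly (hα g (Finset.mem_erase.1 hg).1).1 hp hpg v
  -- Now ker α_g is the zero set of p, hence covered by the fixed spaces of nontrivial elements,
  -- hence contained in one of them; that element is a reflection.
  obtain ⟨r, hr, hrle⟩ : ∃ r : G, r ≠ 1 ∧ LinearMap.ker (α g) ≤ eigenspace r.1 1 := by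
    by_contra! h
    obtain ⟨v, hv, hv'⟩ := exists_mem_forall_notMem (LinearMap.ker (α g))
      ((Finset.univ : Finset G).erase 1) (fun g => eigenspace g.1 1)
      fun r hr => h r (Finset.mem_erase.1 hr).1
    obtain ⟨c, hc⟩ := hpJ
    obtain ⟨r, hr, hrv⟩ := hfix v (by rw [hc, map_mul, (hker v).2 hv, zero_mul])
    exact hv' r (Finset.mem_erase.2 ⟨hr, Finset.mem_univ r⟩) hrv
  exact hw _ ⟨r, r.2, isReflection_of_ker_le (fun h => hr (Subtype.ext h)) hrle, rfl⟩
    (hrle ((hker w).1 hpw))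

end IsBasicInvariants

end MilnorDecomp

namespace MilnorDecomp

open MvPolynomial

variable {l : ℕ} {G : Subgroup ((Fin l → ℂ) ≃ₗ[ℂ] (Fin l → ℂ))}

/-! ### Reflecting hyperplanes and the polynomial `Q` -/

theorem finite_hyperplanes (G : Subgroup ((Fin l → ℂ) ≃ₗ[ℂ] (Fin l → ℂ))) [Finite G] :
    (hyperplanes G).Finite := by
  refine (Set.finite_range fun g : G => eigenspace g.1 1).subset ?_
  rintro _ ⟨g, hg, -, rfl⟩
  exact ⟨⟨g, hg⟩, rfl⟩

theorem finrank_of_mem_hyperplanes {H : Submodule ℂ (Fin l → ℂ)} (hH : H ∈ hyperplanes G) :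
    Module.finrank ℂ H + 1 = l := by
  obtain ⟨g, -, h, rfl⟩ := hH
  exact h

theorem eq_of_le_of_mem_hyperplanes {H H' : Submodule ℂ (Fin l → ℂ)} (hH : H ∈ hyperplanes G)
    (hH' : H' ∈ hyperplanes G) (h : H ≤ H') : H = H' :=
  Submodule.eq_of_le_of_finrank_eq h (by
    have := finrank_of_mem_hyperplanes hH
    have := finrank_of_mem_hyperplanes hH'
    omega)

theorem comap_mem_hyperplanes {g : (Fin l → ℂ) ≃ₗ[ℂ] (Fin l → ℂ)} (hg : g ∈ G)
    {H : Submodule ℂ (Fin l → ℂ)} (hH : H ∈ hyperplanes G) :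
    H.comap (g : (Fin l → ℂ) →ₗ[ℂ] (Fin l → ℂ)) ∈ hyperplanes G := by
  obtain ⟨r, hr, hr', rfl⟩ := hH
  refine ⟨g⁻¹ * r * g, G.mul_mem (G.mul_mem (G.inv_mem hg) hr) hg, ?_, comap_eigenspace g r 1⟩
  unfold IsReflection at hr' ⊢
  rw [← comap_eigenspace, Submodule.comap_equiv_eq_map_symm, LinearEquiv.finrank_map_eq, hr']

theorem hyperplaneOrder_comap {g : (Fin l → ℂ) ≃ₗ[ℂ] (Fin l → ℂ)} (hg : g ∈ G)
    (H : Submodule ℂ (Fin l → ℂ)) :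
    hyperplaneOrder G (H.comap (g : (Fin l → ℂ) →ₗ[ℂ] (Fin l → ℂ))) = hyperplaneOrder G H := by
  refine Nat.card_congr ((MulAut.conj (⟨g, hg⟩ : G)).toEquiv.subtypeEquiv fun x => ?_)
  constructor
  · intro h v hv
    have := h (g.symm v) (by simpa using hv)
    change g (x.1 (g.symm v)) = v
    rw [this, LinearEquiv.apply_symm_apply]
  · intro h v hv
    have : g (x.1 (g.symm (g v))) = g v := h (g v) hv
    rw [LinearEquiv.symm_apply_apply] at this
    exact g.injective this

theorem hyperplaneOrder_ne_zero [Finite G] (H : Submodule ℂ (Fin l → ℂ)) :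
    hyperplaneOrder G H ≠ 0 := by
  have : Nonempty {g : G // ∀ v ∈ H, (g : (Fin l → ℂ) ≃ₗ[ℂ] (Fin l → ℂ)) v = v} :=
    ⟨⟨1, fun v _ => rfl⟩⟩
  exact Nat.card_pos.ne'

/-- Lagrange's theorem in the pointwise stabiliser of H. -/
theorem pow_hyperplaneOrder_eq_one [Finite G] {g : (Fin l → ℂ) ≃ₗ[ℂ] (Fin l → ℂ)} (hg : g ∈ G)
    {H : Submodule ℂ (Fin l → ℂ)} (hH : ∀ v ∈ H, g v = v) : g ^ hyperplaneOrder G H = 1 := by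
  let K : Subgroup G :=
    { carrier := {g | ∀ v ∈ H, (g : (Fin l → ℂ) ≃ₗ[ℂ] (Fin l → ℂ)) v = v}
      mul_mem' := fun {a b} ha hb v hv => by
        rw [Subgroup.coe_mul, LinearEquiv.mul_apply, hb v hv, ha v hv]
      one_mem' := fun v _ => rfl
      inv_mem' := fun {a} ha v hv => (LinearEquiv.symm_apply_eq a.1).2 (ha v hv).symm }
  have h : (⟨⟨g, hg⟩, hH⟩ : K) ^ Nat.card K = 1 := pow_card_eq_one'
  exact congrArg (fun x : K => x.1.1) h

theorem exists_smul_of_ker_eq {α β : (Fin l → ℂ) →ₗ[ℂ] ℂ} (h : LinearMap.ker α = LinearMap.ker β) :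
    ∃ c : ℂ, ∀ v, β v = c * α v := by
  have := mem_span_of_iInf_ker_le_ker (L := fun _ : Unit => α) (K := β) (by simp [h])
  rw [Set.range_const, Submodule.mem_span_singleton] at this
  obtain ⟨c, hc⟩ := this
  exact ⟨c, fun v => by rw [← hc]; rfl⟩

section form

variable {form : Submodule ℂ (Fin l → ℂ) → ((Fin l → ℂ) →ₗ[ℂ] ℂ)}

theorem eval_definingPoly [Finite G] (v : Fin l → ℂ) :
    eval v (definingPoly G form) =
      ∏ H ∈ (finite_hyperplanes G).toFinset, form H v ^ hyperplaneOrder G H := by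
  rw [definingPoly, finprod_mem_eq_finite_toFinset_prod _ (finite_hyperplanes G)]
  simp [map_prod]

theorem eval_definingPoly_ne_zero_iff [Finite G]
    (hform : ∀ H ∈ hyperplanes G, LinearMap.ker (form H) = H) (v : Fin l → ℂ) :
    eval v (definingPoly G form) ≠ 0 ↔ IsRegularVector G v := by
  rw [eval_definingPoly, Finset.prod_ne_zero_iff]
  refine forall_congr' fun H => ?_
  rw [Set.Finite.mem_toFinset]
  refine forall_congr' fun hH => ?_
  rw [ne_eq, pow_eq_zero_iff (hyperplaneOrder_ne_zero H), ← LinearMap.mem_ker, hform H hH]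

theorem definingPoly_isHomogeneous [Finite G] {m : ℕ} [NeZero m]
    (hm : (definingPoly G form).totalDegree = m) : (definingPoly G form).IsHomogeneous m := by
  have h : (definingPoly G form).IsHomogeneous
      (∑ H ∈ (finite_hyperplanes G).toFinset, 1 * hyperplaneOrder G H) := by
    rw [definingPoly, finprod_mem_eq_finite_toFinset_prod _ (finite_hyperplanes G)]
    exact IsHomogeneous.prod _ _ _ fun H _ => (linearFormPoly_isHomogeneous _).pow _
  have h0 : definingPoly G form ≠ 0 := fun h0 => by
    rw [h0, totalDegree_zero] at hm
    exact NeZero.ne m hm.symm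
  rwa [← hm, h.totalDegree h0]

/-- A product over a set of hyperplanes stable under `g` is a semi-invariant of `g`. -/
theorem exists_prod_apply_eq [Finite G] (hform : ∀ H ∈ hyperplanes G, LinearMap.ker (form H) = H)
    {g : (Fin l → ℂ) ≃ₗ[ℂ] (Fin l → ℂ)} (hg : g ∈ G) (T : Finset (Submodule ℂ (Fin l → ℂ)))
    (hT : ∀ H ∈ T, H ∈ hyperplanes G)
    (hgT : ∀ H ∈ T, H.comap (g : (Fin l → ℂ) →ₗ[ℂ] (Fin l → ℂ)) ∈ T) :
    ∃ c : ℂ, ∀ v, ∏ H ∈ T, form H (g v) ^ hyperplaneOrder G H =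
      c * ∏ H ∈ T, form H v ^ hyperplaneOrder G H := by
  have h (H) : ∃ c : ℂ, H ∈ T → ∀ v,
      form H (g v) = c * form (H.comap (g : (Fin l → ℂ) →ₗ[ℂ] (Fin l → ℂ))) v := by
    by_cases hH : H ∈ T
    · obtain ⟨c, hc⟩ := exists_smul_of_ker_eq
        (α := form (H.comap (g : (Fin l → ℂ) →ₗ[ℂ] (Fin l → ℂ))))
        (β := form H ∘ₗ (g : (Fin l → ℂ) →ₗ[ℂ] (Fin l → ℂ))) (by
          rw [hform _ (hT _ (hgT H hH)), LinearMap.ker_comp, hform H (hT H hH)])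
      exact ⟨c, fun _ => hc⟩
    · exact ⟨0, fun h => absurd h hH⟩
  choose c hc using h
  -- Pulling back along g therefore permutes the finite set T and preserves the exponents, so the
  -- product can be reindexed.
  have hinj : Set.InjOn (Submodule.comap (g : (Fin l → ℂ) →ₗ[ℂ] (Fin l → ℂ))) (T : Set _) :=
    (Submodule.comap_injective_of_surjective g.surjective).injOn
  refine ⟨∏ H ∈ T, c H ^ hyperplaneOrder G H, fun v => ?_⟩
  have h2 : ∏ H ∈ T, form (H.comap (g : (Fin l → ℂ) →ₗ[ℂ] (Fin l → ℂ))) v ^ hyperplaneOrder G H =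
      ∏ H ∈ T, form H v ^ hyperplaneOrder G H :=
    Finset.prod_nbij (Submodule.comap (g : (Fin l → ℂ) →ₗ[ℂ] (Fin l → ℂ))) hgT hinj
      (Finset.surjOn_of_injOn_of_card_le _ hgT hinj le_rfl)
      fun H _ => by rw [hyperplaneOrder_comap hg]
  rw [← h2, ← Finset.prod_mul_distrib]
  exact Finset.prod_congr rfl fun H hH => by rw [hc H hH, mul_pow]

/-- The form of the hyperplane H₀ of s is scaled by some a with a^{e_{H₀}} = 1, because s has order
dividing e_{H₀}. The product of the other factors is scaled by a constant c, and evaluating at a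
point of H₀ on no other hyperplane, which s fixes, gives c = 1. -/
theorem eval_definingPoly_apply_of_isReflection [Finite G]
    (hform : ∀ H ∈ hyperplanes G, LinearMap.ker (form H) = H)
    {s : (Fin l → ℂ) ≃ₗ[ℂ] (Fin l → ℂ)} (hs : s ∈ G) (hsr : IsReflection s) (v : Fin l → ℂ) :
    eval (s v) (definingPoly G form) = eval v (definingPoly G form) := by
  classical
  have hH₀ : eigenspace s 1 ∈ hyperplanes G := ⟨s, hs, hsr, rfl⟩
  have hfix (v) (hv : v ∈ eigenspace s 1) : s v = v := by simpa using mem_eigenspace.1 hv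
  have hcomap : (eigenspace s 1).comap (s : (Fin l → ℂ) →ₗ[ℂ] (Fin l → ℂ)) = eigenspace s 1 := by
    rw [comap_eigenspace]; simp
  obtain ⟨c, hc⟩ := exists_prod_apply_eq hform hs
    ((finite_hyperplanes G).toFinset.erase (eigenspace s 1)) (by simp) (fun H hH => by
      rw [Finset.mem_erase, Set.Finite.mem_toFinset] at hH ⊢
      refine ⟨fun h => hH.1 ?_, comap_mem_hyperplanes hs hH.2⟩
      exact Submodule.comap_injective_of_surjective s.surjective (h.trans hcomap.symm))
  obtain ⟨v₀, hv₀, hv₀'⟩ := exists_mem_forall_notMem (eigenspace s 1)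
    ((finite_hyperplanes G).toFinset.erase (eigenspace s 1)) id (fun H hH hle => by
      rw [Finset.mem_erase, Set.Finite.mem_toFinset] at hH
      exact hH.1 (eq_of_le_of_mem_hyperplanes hH₀ hH.2 hle).symm)
  have hc1 : c = 1 := by
    have h := hc v₀
    rw [hfix v₀ hv₀] at h
    refine (mul_right_cancel₀ (Finset.prod_ne_zero_iff.2 fun H hH => ?_)
      ((one_mul _).trans h)).symm
    refine pow_ne_zero _ fun h0 => hv₀' H hH ?_
    rw [id, ← hform H (by simpa using (Finset.mem_erase.1 hH).2)]
    exact h0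
  obtain ⟨a, ha⟩ := exists_smul_of_ker_eq (α := form (eigenspace s 1))
    (β := form (eigenspace s 1) ∘ₗ (s : (Fin l → ℂ) →ₗ[ℂ] (Fin l → ℂ))) (by
      rw [LinearMap.ker_comp, hform _ hH₀, hcomap])
  have hpow (n : ℕ) (v) : form (eigenspace s 1) ((s ^ n) v) = a ^ n * form (eigenspace s 1) v := by
    induction n with
    | zero => simp
    | succ n ih =>
      rw [pow_succ', LinearEquiv.mul_apply, pow_succ', mul_assoc, ← ih]
      exact ha _
  have hs0 : form (eigenspace s 1) (s v) ^ hyperplaneOrder G (eigenspace s 1) =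
      form (eigenspace s 1) v ^ hyperplaneOrder G (eigenspace s 1) := by
    have h1 : form (eigenspace s 1) (s v) = a * form (eigenspace s 1) v := ha v
    have h2 := hpow (hyperplaneOrder G (eigenspace s 1)) v
    rw [pow_hyperplaneOrder_eq_one hs hfix, LinearEquiv.coe_one, id] at h2
    rw [h1, mul_pow]
    by_cases h0 : form (eigenspace s 1) v = 0
    · simp [h0, hyperplaneOrder_ne_zero]
    · rw [mul_right_cancel₀ h0 (h2.symm.trans (one_mul _).symm), one_mul]
  rw [eval_definingPoly, eval_definingPoly,
    ← Finset.mul_prod_erase _ _ ((finite_hyperplanes G).mem_toFinset.2 hH₀),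
    ← Finset.mul_prod_erase _ _ ((finite_hyperplanes G).mem_toFinset.2 hH₀), hs0, hc, hc1, one_mul]

theorem eval_definingPoly_apply [Finite G] (hG : IsReflectionGroup G)
    (hform : ∀ H ∈ hyperplanes G, LinearMap.ker (form H) = H)
    {g : (Fin l → ℂ) ≃ₗ[ℂ] (Fin l → ℂ)} (hg : g ∈ G) (v : Fin l → ℂ) :
    eval (g v) (definingPoly G form) = eval v (definingPoly G form) := by
  rw [← hG] at hg
  induction hg using Subgroup.closure_induction generalizing v with
  | mem s hs => exact eval_definingPoly_apply_of_isReflection hform hs.1 hs.2 v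
  | one => rfl
  | mul x y _ _ hx hy => rw [LinearEquiv.mul_apply, hx, hy]
  | inv x _ hx =>
    rw [← hx]
    exact congrArg (fun w => eval w _) (x.apply_symm_apply v)

end form

end MilnorDecomp

namespace MilnorDecomp

open MvPolynomial

variable {l : ℕ} {G : Subgroup ((Fin l → ℂ) ≃ₗ[ℂ] (Fin l → ℂ))} {deg : Fin l → ℕ}
  {f : Fin l → MvPolynomial (Fin l) ℂ}

/-! ### The strata of the Milnor fibre -/

/-- The greatest common divisor of the degrees of the basic invariants not vanishing at `v`. -/
noncomputable def orbitGcd (deg : Fin l → ℕ) (f : Fin l → MvPolynomial (Fin l) ℂ)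
    (v : Fin l → ℂ) : ℕ :=
  open Classical in (Finset.univ.filter fun i => eval v (f i) ≠ 0).gcd deg

theorem dvd_orbitGcd_iff {d : ℕ} {v : Fin l → ℂ} :
    d ∣ orbitGcd deg f v ↔ ∀ i, eval v (f i) ≠ 0 → d ∣ deg i := by
  simp [orbitGcd, Finset.dvd_gcd_iff]

theorem orbitGcd_congr {v w : Fin l → ℂ} (h : ∀ i, eval v (f i) ≠ 0 ↔ eval w (f i) ≠ 0) :
    orbitGcd deg f v = orbitGcd deg f w := by
  simp only [orbitGcd, h]

namespace IsBasicInvariants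

theorem mem_eigenUnion_iff_dvd [Finite G] (hf : IsBasicInvariants G deg f) {d : ℕ} (hd : d ≠ 0)
    {v : Fin l → ℂ} : v ∈ eigenUnion G d ↔ d ∣ orbitGcd deg f v := by
  rw [hf.mem_eigenUnion_iff hd, dvd_orbitGcd_iff]

theorem orbitGcd_ne_zero [Finite G] (hf : IsBasicInvariants G deg f) {v : Fin l → ℂ}
    (hv : v ≠ 0) : orbitGcd deg f v ≠ 0 := by
  intro h
  obtain ⟨g, -, hg⟩ := hf.exists_apply_eq (v := 0) (w := v) fun i => by
    rw [hf.eval_zero]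
    by_contra hi
    exact hf.deg_ne_zero i (zero_dvd_iff.1 (dvd_orbitGcd_iff.1 (dvd_of_eq h.symm) i (Ne.symm hi)))
  exact hv (by rw [← hg, map_zero])

/-- Let a be this gcd. Then v itself is a regular ζ_a-eigenvector. The degrees divisible by a
include all those with f_i(v) ≠ 0, whose gcd is already a. -/
theorem orbitGcd_mem_regularPoset [Finite G] (hf : IsBasicInvariants G deg f) {v : Fin l → ℂ}
    (hv : v ≠ 0) (hreg : IsRegularVector G v) : orbitGcd deg f v ∈ regularPoset G deg := by
  have h0 := hf.orbitGcd_ne_zero hv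
  obtain ⟨g, hg, hgv⟩ := mem_eigenUnion.1 ((hf.mem_eigenUnion_iff_dvd h0).2 dvd_rfl)
  refine ⟨⟨h0.bot_lt, g, hg, v, mem_eigenspace.2 hgv, hreg⟩, Nat.dvd_antisymm ?_ ?_⟩
  · exact Finset.dvd_gcd fun i hi => (Finset.mem_filter.1 hi).2
  · exact dvd_orbitGcd_iff.2 fun i hi => Finset.gcd_dvd
      (Finset.mem_filter.2 ⟨Finset.mem_univ i, dvd_orbitGcd_iff.1 dvd_rfl i hi⟩)

end IsBasicInvariants

theorem finite_regularPoset (G : Subgroup ((Fin l → ℂ) ≃ₗ[ℂ] (Fin l → ℂ))) (deg : Fin l → ℕ) :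
    (regularPoset G deg).Finite := by
  refine (Set.finite_range fun s : Finset (Fin l) => s.gcd deg).subset ?_
  rintro d ⟨-, hd⟩
  exact ⟨_, hd.symm⟩

/-- `q` is a `G`-invariant homogeneous polynomial of degree `m` whose non-vanishing locus is the set
of regular vectors. -/
structure IsInvariantDiscriminant (G : Subgroup ((Fin l → ℂ) ≃ₗ[ℂ] (Fin l → ℂ))) (m : ℕ)
    (q : MvPolynomial (Fin l) ℂ) : Prop where
  isHomogeneous : q.IsHomogeneous m
  eval_apply : ∀ g ∈ G, ∀ v, eval (g v) q = eval v q
  eval_ne_zero_iff : ∀ v, eval v q ≠ 0 ↔ IsRegularVector G v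

variable {m : ℕ} {q : MvPolynomial (Fin l) ℂ}

namespace IsInvariantDiscriminant

theorem isRegularVector (hq : IsInvariantDiscriminant G m q) {v : Fin l → ℂ}
    (hv : v ∈ milnorFibre q) : IsRegularVector G v :=
  (hq.eval_ne_zero_iff v).1 (by rw [show eval v q = 1 from hv]; exact one_ne_zero)

theorem ne_zero [NeZero m] (hq : IsInvariantDiscriminant G m q) {v : Fin l → ℂ}
    (hv : v ∈ milnorFibre q) : v ≠ 0 := by
  rintro rfl
  have h := eval_smul_of_isHomogeneous hq.isHomogeneous 0 0
  rw [smul_zero, show eval 0 q = 1 from hv, zero_pow (NeZero.ne m), zero_mul] at h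
  exact one_ne_zero h

/-- `F(d)°` consists of the `v ∈ F` for which `d` is the greatest common divisor of the degrees of
the basic invariants not vanishing at `v`. -/
theorem mem_openStratum_iff [Finite G] [NeZero m] (hq : IsInvariantDiscriminant G m q)
    (hf : IsBasicInvariants G deg f) {d : ℕ} (hd : d ∈ regularPoset G deg) {v : Fin l → ℂ} :
    v ∈ openStratum G deg (milnorFibre q) d ↔ v ∈ milnorFibre q ∧ orbitGcd deg f v = d := by
  have hd0 : d ≠ 0 := hd.1.1.ne'
  simp only [openStratum, Set.mem_sdiff, Set.mem_inter_iff, Set.mem_iUnion, Set.mem_ofPred_eq,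
    hf.mem_eigenUnion_iff_dvd hd0, exists_prop, not_exists, not_and]
  constructor
  · rintro ⟨⟨hvF, hdv⟩, hmax⟩
    refine ⟨hvF, by_contra fun hne => ?_⟩
    have hP := hf.orbitGcd_mem_regularPoset (hq.ne_zero hvF) (hq.isRegularVector hvF)
    exact hmax _ ⟨hP, hdv, hne⟩ hvF ((hf.mem_eigenUnion_iff_dvd hP.1.1.ne').2 dvd_rfl)
  · rintro ⟨hvF, rfl⟩
    refine ⟨⟨hvF, dvd_rfl⟩, ?_⟩
    rintro e ⟨he, hde, hne⟩ - hve
    exact hne (Nat.dvd_antisymm ((hf.mem_eigenUnion_iff_dvd he.1.1.ne').1 hve) hde)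

/-- `(F ∩ E_d)°` is not empty. -/
theorem nonempty_openStratum_inter [Finite G] [NeZero m] (hq : IsInvariantDiscriminant G m q)
    (hf : IsBasicInvariants G deg f) {d : ℕ} (hd : d ∈ regularPoset G deg)
    {E : Submodule ℂ (Fin l → ℂ)} (hE : IsMaximalEigenspace G (zeta d) E) :
    (openStratum G deg (milnorFibre q) d ∩ E).Nonempty := by
  classical
  obtain ⟨⟨hd0, g₀, hg₀, v₀, hv₀, hreg₀⟩, hgcd⟩ := id hd
  -- The regular eigenvector `v₀` need not lie in E, but by Springer's theorem its G-orbit meets E.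
  have hqE : ∃ v ∈ E, eval v q ≠ 0 := by
    obtain ⟨v, hv, hfv⟩ := hf.exists_mem_maximal_eval_eq hd0.ne' hE
      ((hf.mem_eigenUnion_iff hd0.ne').1 (mem_eigenUnion.2 ⟨g₀, hg₀, mem_eigenspace.1 hv₀⟩))
    obtain ⟨x, hx, hxv⟩ := hf.exists_apply_eq hfv
    refine ⟨v, hv, ?_⟩
    rw [← hq.eval_apply x hx, hxv]
    exact (hq.eval_ne_zero_iff v₀).2 hreg₀
  -- A generic point of E: `none` stands for q, and `some i` for the f_i with d ∣ deg i. Its gcd is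
  -- then the one in the definition of 𝒫, namely d.
  obtain ⟨v, hv, hv'⟩ := exists_mem_forall_eval_ne_zero E
    (insert none ((Finset.univ.filter fun i => d ∣ deg i).image some)) (fun o => o.elim q f) (by
      intro o ho
      rcases o with _ | i
      · exact hqE
      · have hi : d ∣ deg i := by simpa using ho
        obtain ⟨v, hv, hfv⟩ := hf.exists_mem_maximal_eval_eq hd0.ne' hE (y := Pi.single i 1)
          fun j hj => by
            by_cases hij : j = i
            · rwa [hij]
            · exact absurd (Pi.single_eq_of_ne hij 1) hj
        exact ⟨v, hv, by simp [hfv]⟩)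
  have hqv : eval v q ≠ 0 := hv' none (by simp)
  -- Rescaling by c moves v into F without changing which f_i vanish.
  obtain ⟨c, hc⟩ := IsAlgClosed.exists_pow_nat_eq (eval v q)⁻¹ (NeZero.pos m)
  have hc0 : c ≠ 0 := by
    rintro rfl
    rw [zero_pow (NeZero.ne m)] at hc
    exact inv_ne_zero hqv hc.symm
  refine ⟨c • v, (hq.mem_openStratum_iff hf hd).2 ⟨?_, ?_⟩, E.smul_mem c hv⟩
  · change eval (c • v) q = 1
    rw [eval_smul_of_isHomogeneous hq.isHomogeneous, hc, inv_mul_cancel₀ hqv]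
  · obtain ⟨⟨g, hg, rfl⟩, -⟩ := hE
    refine Eq.trans ?_ hgcd.symm
    rw [orbitGcd]
    congr 1
    refine Finset.filter_congr fun i _ => ?_
    rw [hf.eval_smul, mul_ne_zero_iff_left (pow_ne_zero _ hc0)]
    exact ⟨(hf.mem_eigenUnion_iff hd0.ne').1 (mem_eigenUnion.2 ⟨g, hg, mem_eigenspace.1 hv⟩) i,
      fun hi => hv' (some i) (by simpa using hi)⟩

end IsInvariantDiscriminant

/-! ### The action of `Γ` on the strata -/

theorem gam_smul_def (γ : Gam G m) (v : Fin l → ℂ) :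
    γ • v = (((γ.2⁻¹ : rootsOfUnity m ℂ) : ℂˣ) : ℂ) •
      (γ.1 : (Fin l → ℂ) ≃ₗ[ℂ] (Fin l → ℂ)) v := rfl

theorem rootsOfUnity_pow_eq_one (ξ : rootsOfUnity m ℂ) : ((ξ : ℂˣ) : ℂ) ^ m = 1 := by
  have := (mem_rootsOfUnity' m _).1 ξ.2
  exact this

theorem gam_smul_eq_iff (γ : Gam G m) (v : Fin l → ℂ) :
    γ • v = v ↔ (γ.1 : (Fin l → ℂ) ≃ₗ[ℂ] (Fin l → ℂ)) v = ((γ.2 : ℂˣ) : ℂ) • v := by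
  rw [gam_smul_def, InvMemClass.coe_inv, ← Units.smul_def, inv_smul_eq_iff, Units.smul_def]

theorem mem_gamCentralizer_iff {g : G} {γ : Gam G m} :
    γ ∈ gamCentralizer m g ↔ g * γ.1 = γ.1 * g := by
  simp [gamCentralizer, Subgroup.mem_prod, Subgroup.mem_centralizer_iff]

theorem gam_orbitGcd_smul (hf : IsBasicInvariants G deg f) (γ : Gam G m) (v : Fin l → ℂ) :
    orbitGcd deg f (γ • v) = orbitGcd deg f v :=
  orbitGcd_congr fun i => by
    rw [gam_smul_def, hf.eval_smul, hf.eval_apply γ.1.2,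
      mul_ne_zero_iff_left (pow_ne_zero _ (Units.ne_zero _))]

namespace IsInvariantDiscriminant

theorem gam_smul_mem_iff (hq : IsInvariantDiscriminant G m q) (γ : Gam G m) (v : Fin l → ℂ) :
    γ • v ∈ milnorFibre q ↔ v ∈ milnorFibre q := by
  change eval (γ • v) q = 1 ↔ eval v q = 1
  rw [gam_smul_def, eval_smul_of_isHomogeneous hq.isHomogeneous, rootsOfUnity_pow_eq_one, one_mul,
    hq.eval_apply _ γ.1.2]

theorem gam_smul_mem_openStratum_iff [Finite G] [NeZero m] (hq : IsInvariantDiscriminant G m q)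
    (hf : IsBasicInvariants G deg f) {d : ℕ} (hd : d ∈ regularPoset G deg) (γ : Gam G m)
    (v : Fin l → ℂ) : γ • v ∈ openStratum G deg (milnorFibre q) d ↔
      v ∈ openStratum G deg (milnorFibre q) d := by
  rw [hq.mem_openStratum_iff hf hd, hq.mem_openStratum_iff hf hd, hq.gam_smul_mem_iff,
    gam_orbitGcd_smul hf]

/-- Write x for the G-part of γ. The vector γv is again a ζ_d-eigenvector of g iff gxv = xgv; as v
is regular, Steinberg's theorem turns this into gx = xg. -/
theorem gam_smul_mem_inter_iff [Finite G] [NeZero m] (hq : IsInvariantDiscriminant G m q)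
    (hf : IsBasicInvariants G deg f) {d : ℕ} (hd : d ∈ regularPoset G deg) (g : G) (γ : Gam G m)
    {v : Fin l → ℂ}
    (hv : v ∈ openStratum G deg (milnorFibre q) d ∩ eigenspace (g : (Fin l → ℂ) ≃ₗ[ℂ] _) (zeta d)) :
    γ • v ∈ openStratum G deg (milnorFibre q) d ∩ eigenspace (g : (Fin l → ℂ) ≃ₗ[ℂ] _) (zeta d) ↔
      γ ∈ gamCentralizer m g := by
  have hvg := mem_eigenspace.1 hv.2
  have hvr := hq.isRegularVector hv.1.1.1
  rw [Set.mem_inter_iff, hq.gam_smul_mem_openStratum_iff hf hd, and_iff_right hv.1,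
    mem_gamCentralizer_iff, gam_smul_def, SetLike.mem_coe,
    Submodule.smul_mem_iff _ (Units.ne_zero _), mem_eigenspace]
  constructor
  · intro h
    have h1 : (γ.1 * g)⁻¹ * (g * γ.1) = 1 := by
      refine Subtype.ext (hf.eq_one_of_isRegularVector hvr ((γ.1 * g)⁻¹ * (g * γ.1)).2 ?_)
      have h2 : (g : (Fin l → ℂ) ≃ₗ[ℂ] (Fin l → ℂ)) ((γ.1 : (Fin l → ℂ) ≃ₗ[ℂ] (Fin l → ℂ)) v) =
          (γ.1 : (Fin l → ℂ) ≃ₗ[ℂ] (Fin l → ℂ)) ((g : (Fin l → ℂ) ≃ₗ[ℂ] (Fin l → ℂ)) v) := by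
        rw [h, hvg, map_smul]
      exact (LinearEquiv.symm_apply_eq
        ((γ.1 * g : G) : (Fin l → ℂ) ≃ₗ[ℂ] (Fin l → ℂ))).2 h2
    exact (inv_mul_eq_one.1 h1).symm
  · intro h
    have h2 := congrArg (fun x : G => (x : (Fin l → ℂ) ≃ₗ[ℂ] (Fin l → ℂ)) v) h
    refine Eq.trans h2 ?_
    rw [Subgroup.coe_mul, LinearEquiv.mul_apply, hvg, map_smul]

theorem stabilizer_milnorFibre (hq : IsInvariantDiscriminant G m q) :
    MulAction.stabilizer (Gam G m) (milnorFibre q) = ⊤ :=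
  eq_top_iff.2 fun γ _ => MulAction.mem_stabilizer_set.2 (hq.gam_smul_mem_iff γ)

theorem stabilizer_openStratum_inter [Finite G] [NeZero m] (hq : IsInvariantDiscriminant G m q)
    (hf : IsBasicInvariants G deg f) {d : ℕ} (hd : d ∈ regularPoset G deg) (g : G)
    (hE : IsMaximalEigenspace G (zeta d) (eigenspace (g : (Fin l → ℂ) ≃ₗ[ℂ] _) (zeta d))) :
    MulAction.stabilizer (Gam G m)
      (openStratum G deg (milnorFibre q) d ∩ eigenspace (g : (Fin l → ℂ) ≃ₗ[ℂ] _) (zeta d)) =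
      gamCentralizer m g := by
  ext γ
  rw [MulAction.mem_stabilizer_set]
  constructor
  · intro h
    obtain ⟨v, hv⟩ := hq.nonempty_openStratum_inter hf hd hE
    exact (hq.gam_smul_mem_inter_iff hf hd g γ hv).1 ((h v).2 hv)
  · intro h v
    refine ⟨fun hv => ?_, fun hv => (hq.gam_smul_mem_inter_iff hf hd g γ hv).2 h⟩
    simpa using (hq.gam_smul_mem_inter_iff hf hd g γ⁻¹ hv).2 (inv_mem h)

/-- `F` is covered by the `Γ`-translates of the `(F ∩ E_d)°`. -/
theorem exists_mem_smul_openStratum_inter [Finite G] [NeZero m] (hq : IsInvariantDiscriminant G m q)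
    (hf : IsBasicInvariants G deg f) (g : ℕ → G)
    (hE : ∀ d ∈ regularPoset G deg,
      IsMaximalEigenspace G (zeta d) (eigenspace (g d : (Fin l → ℂ) ≃ₗ[ℂ] _) (zeta d)))
    {v : Fin l → ℂ} (hv : v ∈ milnorFibre q) : ∃ d ∈ regularPoset G deg, ∃ γ : Gam G m,
      γ • v ∈ openStratum G deg (milnorFibre q) d ∩
        eigenspace (g d : (Fin l → ℂ) ≃ₗ[ℂ] _) (zeta d) := by
  have hd := hf.orbitGcd_mem_regularPoset (hq.ne_zero hv) (hq.isRegularVector hv)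
  refine ⟨_, hd, ?_⟩
  obtain ⟨w, hw, hfw⟩ := hf.exists_mem_maximal_eval_eq hd.1.1.ne' (hE _ hd)
    (dvd_orbitGcd_iff.1 dvd_rfl)
  obtain ⟨x, hx, hxv⟩ := hf.exists_apply_eq fun i => (hfw i).symm
  refine ⟨(⟨x, hx⟩, 1), (hq.gam_smul_mem_openStratum_iff hf hd _ _).2
    ((hq.mem_openStratum_iff hf hd).2 ⟨hv, rfl⟩), ?_⟩
  have : ((⟨x, hx⟩, 1) : Gam G m) • v = w := by
    rw [gam_smul_def]
    simpa using hxv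
  rw [this]
  exact hw

/-- The quotient of `Γ(d)` by `R(d)` acts freely on `(F ∩ E_d)°`. -/
theorem exists_rootsOfUnity_eq_zeta [Finite G] [NeZero m] (hq : IsInvariantDiscriminant G m q)
    (hf : IsBasicInvariants G deg f) {d : ℕ} (hd : d ∈ regularPoset G deg) (g : G)
    (hE : IsMaximalEigenspace G (zeta d) (eigenspace (g : (Fin l → ℂ) ≃ₗ[ℂ] _) (zeta d))) :
    ∃ ξ : rootsOfUnity m ℂ, ((ξ : ℂˣ) : ℂ) = zeta d ∧
      Subgroup.zpowers ((g, ξ) : Gam G m) ≤ gamCentralizer m g ∧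
      ((Subgroup.zpowers ((g, ξ) : Gam G m)).subgroupOf (gamCentralizer m g)).Normal ∧
      ∀ v ∈ openStratum G deg (milnorFibre q) d ∩ eigenspace (g : (Fin l → ℂ) ≃ₗ[ℂ] _) (zeta d),
        ∀ γ ∈ gamCentralizer m g,
          γ • v = v ↔ γ ∈ Subgroup.zpowers ((g, ξ) : Gam G m) := by
  have hd0 : d ≠ 0 := hd.1.1.ne'
  -- For v in F ∩ E_d, invariance and homogeneity give 1 = q(gv) = ζ_d^m q(v) = ζ_d^m.
  have hζ : zeta d ^ m = 1 := by
    obtain ⟨v, hv⟩ := hq.nonempty_openStratum_inter hf hd hE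
    have h := hq.eval_apply g g.2 v
    rw [mem_eigenspace.1 hv.2, eval_smul_of_isHomogeneous hq.isHomogeneous,
      show eval v q = 1 from hv.1.1.1, mul_one] at h
    exact h
  refine ⟨rootsOfUnity.mkOfPowEq (zeta d) hζ, rootsOfUnity.val_mkOfPowEq_coe _ _, ?_⟩
  generalize hξ : rootsOfUnity.mkOfPowEq (zeta d) hζ = ξ
  have hξ' : ((ξ : ℂˣ) : ℂ) = zeta d := by rw [← hξ]; exact rootsOfUnity.val_mkOfPowEq_coe _ _
  refine ⟨?_, ⟨?_⟩, ?_⟩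
  · rw [Subgroup.zpowers_le, mem_gamCentralizer_iff]
  · intro x hx y
    -- R(d) is even central in Γ(d).
    have hxy : y * x * y⁻¹ = x := by
      rw [Subgroup.mem_subgroupOf] at hx
      obtain ⟨k, hk⟩ := Subgroup.mem_zpowers_iff.1 hx
      have hcomm : Commute ((g, ξ) : Gam G m) y :=
        Prod.ext (mem_gamCentralizer_iff.1 y.2) (mul_comm _ _)
      have h := (hcomm.zpow_left k).eq
      rw [hk] at h
      exact mul_inv_eq_of_eq_mul (Subtype.ext h.symm)
    rwa [hxy]
  · intro v hv γ hγ
    have hvg := mem_eigenspace.1 hv.2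
    have hfix : ((g, ξ) : Gam G m) • v = v := by rw [gam_smul_eq_iff, hvg, hξ']
    have hfixz (k : ℤ) : ((g, ξ) : Gam G m) ^ k • v = v :=
      (MulAction.stabilizer (Gam G m) v).zpow_mem hfix k
    constructor
    · intro h
      have hγv := (gam_smul_eq_iff γ v).1 h
      obtain ⟨hvF, hvd⟩ := (hq.mem_openStratum_iff hf hd).1 hv.1
      -- The order of the eigenvalue divides every degree whose invariant is nonzero at v, hence
      -- divides their gcd d.
      have hpow : ((γ.2 : ℂˣ) : ℂ) ^ d = 1 := by
        have h1 : orderOf ((γ.2 : ℂˣ) : ℂ) ∣ orbitGcd deg f v :=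
          dvd_orbitGcd_iff.2 fun i hi =>
            orderOf_dvd_of_pow_eq_one (hf.pow_deg_eq_one γ.1.2 hγv hi)
        rw [hvd] at h1
        exact orderOf_dvd_iff_pow_eq_one.1 h1
      have : NeZero d := ⟨hd0⟩
      obtain ⟨k, -, hk⟩ := (isPrimitiveRoot_zeta hd0).eq_pow_of_pow_eq_one hpow
      refine Subgroup.mem_zpowers_iff.2 ⟨k, ?_⟩
      have h2 : (((g, ξ) : Gam G m) ^ (k : ℤ)).2 = γ.2 := by
        refine Subtype.ext (Units.ext ?_)
        simp [hξ', hk]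
      refine Prod.ext ?_ h2
      have h3 : ((((g, ξ) : Gam G m) ^ (k : ℤ)).1 : (Fin l → ℂ) ≃ₗ[ℂ] (Fin l → ℂ)) v =
          (γ.1 : (Fin l → ℂ) ≃ₗ[ℂ] (Fin l → ℂ)) v := by
        rw [hγv, (gam_smul_eq_iff _ v).1 (hfixz k), h2]
      generalize (((g, ξ) : Gam G m) ^ (k : ℤ)).1 = x at h3 ⊢
      have h4 : x⁻¹ * γ.1 = 1 := Subtype.ext (hf.eq_one_of_isRegularVector
        (hq.isRegularVector hvF) (x⁻¹ * γ.1).2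
        ((LinearEquiv.symm_apply_eq (x : (Fin l → ℂ) ≃ₗ[ℂ] (Fin l → ℂ))).2 h3.symm))
      exact inv_mul_eq_one.1 h4
    · intro h
      obtain ⟨k, rfl⟩ := Subgroup.mem_zpowers_iff.1 h
      exact hfixz k

end IsInvariantDiscriminant

end MilnorDecomp

namespace MilnorDecomp

/-! ### Traces on `A ⊗ R(H)` -/

section trace

variable {A : Type*} [CommRing A] [Algebra ℂ A]

theorem trace_tmul {H : Type*} [Group H] (x : H) (a : A) (χ : RepRing H) :
    trace A x (a ⊗ₜ[ℂ] χ) = χ.1 x • a := by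
  simp [trace]

/-- An element of `A ⊗ R(H)` is determined by its traces. -/
theorem eq_of_forall_trace_eq {H : Type*} [Group H] [Finite H] {z w : A ⊗[ℂ] RepRing H}
    (h : ∀ x : H, trace A x z = trace A x w) : z = w := by
  classical
  have := Fintype.ofFinite H
  -- By flatness A ⊗ R(H) embeds in A ⊗ (H → ℂ) = (H → A), whose coordinates are the traces.
  have hinj : Function.Injective (LinearMap.lTensor A (RepRing H).val.toLinearMap) :=
    Module.Flat.lTensor_preserves_injective_linearMap _ Subtype.val_injective
  refine hinj ((TensorProduct.piScalarRight ℂ ℂ A H).injective (funext fun x => ?_))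
  have htr (z : A ⊗[ℂ] RepRing H) : TensorProduct.piScalarRight ℂ ℂ A H
      (LinearMap.lTensor A (RepRing H).val.toLinearMap z) x = trace A x z := by
    induction z using TensorProduct.induction_on with
    | zero => simp
    | tmul a χ => rw [trace_tmul]; simp
    | add a b ha hb => simp only [map_add, Pi.add_apply, ha, hb]
  rw [htr, htr, h]

theorem trace_lTensor_res {K L : Type*} [Group K] [Group L] (φ : K →* L) (x : K)
    (z : A ⊗[ℂ] RepRing L) :
    trace A x (LinearMap.lTensor A (RepRing.res φ) z) = trace A (φ x) z := by
  induction z using TensorProduct.induction_on with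
  | zero => simp
  | tmul a χ => rw [LinearMap.lTensor_tmul, trace_tmul, trace_tmul]; rfl
  | add a b ha hb => simp only [map_add, ha, hb]

open Classical in
/-- The trace extended by zero from a subgroup. -/
noncomputable def traceExtend {Γ : Type*} [Group Γ] (K : Subgroup Γ) (x : Γ)
    (z : A ⊗[ℂ] RepRing K) : A :=
  if h : x ∈ K then trace A (⟨x, h⟩ : K) z else 0

theorem trace_lTensor_ind {Γ : Type*} [Group Γ] [Fintype Γ] (K : Subgroup Γ)
    (x : (⊤ : Subgroup Γ)) (z : A ⊗[ℂ] RepRing K) :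
    trace A x (LinearMap.lTensor A (RepRing.ind (le_top : K ≤ ⊤)) z) =
      (Nat.card K : ℂ)⁻¹ • ∑ y : Γ, traceExtend K (y⁻¹ * x * y) z := by
  induction z using TensorProduct.induction_on with
  | zero => simp [traceExtend]
  | tmul a χ =>
    have h : ((RepRing.ind (le_top : K ≤ ⊤)) χ).1 x =
        (Nat.card K : ℂ)⁻¹ * ∑ y : Γ, extendZero K χ.1 (y⁻¹ * x * y) := by
      rw [← finsum_eq_sum_of_fintype, ← finsum_comp_equiv Subgroup.topEquiv.toEquiv]
      rfl
    rw [LinearMap.lTensor_tmul, trace_tmul, h, mul_smul, Finset.sum_smul]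
    congr 1
    refine Finset.sum_congr rfl fun y _ => ?_
    unfold extendZero traceExtend
    split_ifs with h
    · rw [trace_tmul]
    · rw [zero_smul]
  | add a b ha hb =>
    rw [map_add, map_add, ha, hb, ← smul_add, ← Finset.sum_add_distrib]
    congr 1
    refine Finset.sum_congr rfl fun y _ => ?_
    unfold traceExtend
    split_ifs
    · rw [map_add]
    · rw [add_zero]

end trace

theorem sum_quotient_mk {Γ S : Type*} [Group Γ] [Fintype Γ] [AddCommMonoid S] (K : Subgroup Γ)
    [Fintype (Γ ⧸ K)] (φ : Γ ⧸ K → S) :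
    ∑ y : Γ, φ (QuotientGroup.mk y) = Nat.card K • ∑ q, φ q := by
  classical
  rw [Finset.smul_sum, ← Finset.sum_fiberwise _ (QuotientGroup.mk : Γ → Γ ⧸ K)]
  refine Finset.sum_congr rfl fun q _ => ?_
  rw [Finset.sum_congr rfl (g := fun _ => φ q) fun y hy => by rw [(Finset.mem_filter.1 hy).2],
    Finset.sum_const]
  congr 1
  have h := QuotientGroup.card_preimage_mk K {q}
  rw [Nat.card_coe_set_eq ({q} : Set (Γ ⧸ K)), Set.ncard_singleton, mul_one] at h
  rw [← h, Nat.card_eq_fintype_card, Fintype.card_subtype]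
  simp

/-! ### Finite additivity -/

/-- The family B is left general because it is also applied to the constructible sets stable under a
fixed γ, where only equivariant subdivision is additive. -/
theorem apply_biUnion_eq_sum {X S ι : Type*} [AddCommGroup S] {B : Set (Set X)} (h0 : ∅ ∈ B)
    (hU : ∀ s ∈ B, ∀ t ∈ B, s ∪ t ∈ B) {β : Set X → S}
    (hβ : ∀ Y ∈ B, ∀ Z ∈ B, Z ⊆ Y → β Y = β Z + β (Y \ Z)) {Z : ι → Set X}
    (hd : Pairwise fun i j => Disjoint (Z i) (Z j)) (T : Finset ι) (hZ : ∀ i ∈ T, Z i ∈ B) :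
    β (⋃ i ∈ T, Z i) = ∑ i ∈ T, β (Z i) := by
  classical
  suffices h : (⋃ i ∈ T, Z i) ∈ B ∧ β (⋃ i ∈ T, Z i) = ∑ i ∈ T, β (Z i) from h.2
  induction T using Finset.induction_on with
  | empty =>
    have h := hβ ∅ h0 ∅ h0 le_rfl
    rw [Set.sdiff_self, left_eq_add] at h
    simpa [h] using h0
  | insert a T ha ih =>
    obtain ⟨ih1, ih2⟩ := ih fun i hi => hZ i (Finset.mem_insert_of_mem hi)
    have hB : Z a ∪ ⋃ i ∈ T, Z i ∈ B := hU _ (hZ a (Finset.mem_insert_self a T)) _ ih1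
    have hdis : Disjoint (⋃ i ∈ T, Z i) (Z a) := by
      simp only [Set.disjoint_iUnion_left]
      exact fun i hi => hd (by rintro rfl; exact ha hi)
    rw [Finset.set_biUnion_insert, Finset.sum_insert ha, ← ih2]
    refine ⟨hB, ?_⟩
    rw [hβ _ hB _ (hZ a (Finset.mem_insert_self a T)) Set.subset_union_left,
      Set.union_sdiff_left, hdis.sdiff_eq_left]

/-! ### Sets covered by disjoint translates -/

/-- `F` is the disjoint union of the translates `γ Y_d`, where `γ` runs over `Γ / K_d`; all of them
lie in `B`, which is closed under finite unions. -/
structure IsInducedPartition {Γ X D : Type*} [Group Γ] [MulAction Γ X] (B : Set (Set X))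
    (K : D → Subgroup Γ) (Y : D → Set X) (F : Set X) : Prop where
  empty_mem : ∅ ∈ B
  union_mem : ∀ s ∈ B, ∀ t ∈ B, s ∪ t ∈ B
  smul_mem : ∀ d (γ : Γ), γ • Y d ∈ B
  stabilizer_eq : ∀ d, MulAction.stabilizer Γ (Y d) = K d
  eq_and_mem : ∀ d d' (γ : Γ) x, x ∈ Y d → γ • x ∈ Y d' → d = d' ∧ γ ∈ K d
  mem_iff : ∀ x, x ∈ F ↔ ∃ d, ∃ γ : Γ, γ • x ∈ Y d

/-- The translate of `Y_d` belonging to a coset of `K_d`. -/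
noncomputable def piece {Γ X D : Type*} [Group Γ] [MulAction Γ X] (K : D → Subgroup Γ)
    (Y : D → Set X) (i : Σ d, Γ ⧸ K d) : Set X :=
  i.2.out • Y i.1

namespace IsInducedPartition

variable {Γ X D : Type*} [Group Γ] [MulAction Γ X] {B : Set (Set X)} {K : D → Subgroup Γ}
  {Y : D → Set X} {F : Set X}

theorem piece_mk (h : IsInducedPartition B K Y F) (d : D) (γ : Γ) :
    piece K Y ⟨d, QuotientGroup.mk γ⟩ = γ • Y d := by
  obtain ⟨k, hk⟩ := QuotientGroup.mk_out_eq_mul (K d) γ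
  have hk' : (k : Γ) • Y d = Y d := by
    rw [← MulAction.mem_stabilizer_iff, h.stabilizer_eq]
    exact k.2
  rw [piece, hk, mul_smul, hk']

theorem smul_piece (h : IsInducedPartition B K Y F) (γ : Γ) (i : Σ d, Γ ⧸ K d) :
    γ • piece K Y i = piece K Y ⟨i.1, γ • i.2⟩ := by
  obtain ⟨d, q⟩ := i
  induction q using QuotientGroup.induction_on with
  | H y => rw [piece_mk h, smul_smul, ← piece_mk h]; rfl

theorem disjoint_piece (h : IsInducedPartition B K Y F) :
    Pairwise fun i j => Disjoint (piece K Y i) (piece K Y j) := by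
  rintro ⟨d, q⟩ ⟨d', q'⟩ hne
  induction q using QuotientGroup.induction_on with | H y => ?_
  induction q' using QuotientGroup.induction_on with | H y' => ?_
  rw [piece_mk h, piece_mk h, Set.disjoint_left]
  intro x hx hx'
  rw [Set.mem_smul_set_iff_inv_smul_mem] at hx hx'
  obtain ⟨rfl, hK⟩ := h.eq_and_mem d d' (y'⁻¹ * y) (y⁻¹ • x) hx (by simpa [mul_smul] using hx')
  exact hne (by rw [(QuotientGroup.eq (s := K d)).2 hK])

theorem iUnion_piece (h : IsInducedPartition B K Y F) : ⋃ i, piece K Y i = F := by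
  ext x
  rw [h.mem_iff, Set.mem_iUnion]
  constructor
  · rintro ⟨⟨d, q⟩, hx⟩
    exact ⟨d, q.out⁻¹, Set.mem_smul_set_iff_inv_smul_mem.1 hx⟩
  · rintro ⟨d, γ, hx⟩
    refine ⟨⟨d, QuotientGroup.mk γ⁻¹⟩, ?_⟩
    rwa [piece_mk h, Set.mem_smul_set_iff_inv_smul_mem, inv_inv]

/-- The value of an equivariant additive function with values in a `Γ`-module. -/
theorem apply_eq_finsum [Finite Γ] [Finite D] (h : IsInducedPartition B K Y F) {S : Type*}
    [AddCommGroup S] [DistribMulAction Γ S] {β : Set X → S}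
    (hadd : ∀ Y ∈ B, ∀ Z ∈ B, Z ⊆ Y → β Y = β Z + β (Y \ Z))
    (hsmul : ∀ (γ : Γ), ∀ Y ∈ B, β (γ • Y) = γ • β Y) :
    β F = ∑ᶠ d, ∑ᶠ q : Γ ⧸ K d, q.out • β (Y d) := by
  have := Fintype.ofFinite D
  have (d : D) := Fintype.ofFinite (Γ ⧸ K d)
  have h1 := apply_biUnion_eq_sum h.empty_mem h.union_mem hadd h.disjoint_piece Finset.univ
    fun i _ => h.smul_mem _ _
  simp only [Finset.mem_univ, Set.iUnion_true, iUnion_piece h] at h1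
  rw [h1, finsum_eq_sum_of_fintype, Fintype.sum_sigma]
  refine Finset.sum_congr rfl fun d _ => ?_
  rw [finsum_eq_sum_of_fintype]
  exact Finset.sum_congr rfl fun q _ => hsmul _ _ (by simpa using h.smul_mem d 1)

end IsInducedPartition

/-! ### Additive functors -/

namespace AdditiveFunctor

variable {Γ X : Type*} [Group Γ] [MulAction Γ X] {B : Set (Set X)} {A : Type*} [CommRing A]
  [Algebra ℂ A]

/-- The trace at `γ` of `β_{⟨γ⟩}(Y)`. -/
noncomputable def localTrace (β : AdditiveFunctor Γ B A) (γ : Γ) (Y : Set X) : A :=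
  trace A (⟨γ, Subgroup.mem_zpowers γ⟩ : Subgroup.zpowers γ) (β.val (Subgroup.zpowers γ) Y)

/-- Restricting to ⟨x⟩ reduces every trace to a cyclic group, the setting of the axiom on permuted
pieces. -/
theorem trace_val (β : AdditiveFunctor Γ B A) {H : Subgroup Γ} {Y : Set X} (hY : Y ∈ B)
    (hH : H ≤ MulAction.stabilizer Γ Y) (x : H) : trace A x (β.val H Y) = β.localTrace x Y := by
  rw [localTrace, ← β.res_val (Subgroup.zpowers (x : Γ)) H (by simp) Y hY hH, trace_lTensor_res]
  rfl

theorem localTrace_smul (β : AdditiveFunctor Γ B A) (δ : Γ) {γ : Γ} {Y : Set X} (hY : Y ∈ B)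
    (hδY : δ • Y ∈ B) (hγ : γ • Y = Y) :
    β.localTrace (δ * γ * δ⁻¹) (δ • Y) = β.localTrace γ Y := by
  have hst : Subgroup.zpowers γ ≤ MulAction.stabilizer Γ Y := Subgroup.zpowers_le.2 hγ
  conv_rhs => rw [localTrace, ← β.smul_val δ (Subgroup.zpowers γ) Y hY hst, trace_lTensor_res]
  rw [trace_val β hδY]
  · rfl
  · rintro _ ⟨x, hx, rfl⟩
    have hx' : x • Y = Y := hst hx
    rw [MulAction.mem_stabilizer_iff]
    simp [mul_smul, hx']

/-- The induction formula for additive functors. -/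
theorem val_top_eq_finsum [Finite Γ] {D : Type*} [Finite D] (β : AdditiveFunctor Γ B A)
    {K : D → Subgroup Γ} {Y : D → Set X} {F : Set X} (h : IsInducedPartition B K Y F) :
    β.val ⊤ F = ∑ᶠ d, LinearMap.lTensor A (RepRing.ind (le_top : K d ≤ ⊤)) (β.val (K d) (Y d)) := by
  classical
  have := Fintype.ofFinite D
  have := Fintype.ofFinite Γ
  have (d : D) := Fintype.ofFinite (Γ ⧸ K d)
  have hmem (T : Finset (Σ d, Γ ⧸ K d)) : (⋃ i ∈ T, piece K Y i) ∈ B := by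
    induction T using Finset.induction_on with
    | empty => simpa using h.empty_mem
    | insert a T ha ih =>
      rw [Finset.set_biUnion_insert]
      exact h.union_mem _ (h.smul_mem _ _) _ ih
  have hYB (d) : Y d ∈ B := by simpa using h.smul_mem d 1
  have hFB : F ∈ B := by simpa [h.iUnion_piece] using hmem Finset.univ
  have hFst : MulAction.stabilizer Γ F = ⊤ := by
    refine eq_top_iff.2 fun γ _ => MulAction.mem_stabilizer_set.2 fun x => ?_
    rw [h.mem_iff, h.mem_iff]
    refine exists_congr fun d => ⟨?_, ?_⟩
    · rintro ⟨δ, hδ⟩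
      exact ⟨δ * γ, by rwa [mul_smul]⟩
    · rintro ⟨δ, hδ⟩
      exact ⟨δ * γ⁻¹, by simpa [mul_smul] using hδ⟩
  refine eq_of_forall_trace_eq fun x => ?_
  obtain ⟨γ, hγ⟩ := x
  rw [trace_val β hFB hFst.ge, finsum_eq_sum_of_fintype, map_sum]
  change β.localTrace γ F = _
  let σ : Equiv.Perm (Σ d, Γ ⧸ K d) := Equiv.sigmaCongrRight fun d => MulAction.toPerm γ
  have hσ (i) : γ • piece K Y i = piece K Y (σ i) := h.smul_piece γ i
  -- the pieces fixed by `γ` and the others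
  let B' : Set (Set X) := {Z | Z ∈ B ∧ γ • Z = Z}
  have hadd' : ∀ Y ∈ B', ∀ Z ∈ B', Z ⊆ Y →
      β.localTrace γ Y = β.localTrace γ Z + β.localTrace γ (Y \ Z) := fun Y hY Z hZ hZY => by
    rw [localTrace, β.additive _ Y Z hY.1 hZ.1 hZY (Subgroup.zpowers_le.2 hY.2)
      (Subgroup.zpowers_le.2 hZ.2), map_add]
    rfl
  have hfix := apply_biUnion_eq_sum (B := B') ⟨h.empty_mem, Set.smul_set_empty⟩
    (fun s hs t ht => ⟨h.union_mem s hs.1 t ht.1, by rw [Set.smul_set_union, hs.2, ht.2]⟩)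
    hadd' h.disjoint_piece (Finset.univ.filter fun i => σ i = i) fun i hi =>
      ⟨h.smul_mem _ _, by rw [hσ, (Finset.mem_filter.1 hi).2]⟩
  -- γ permutes the moved pieces among themselves without fixed points; numbering them by `Fin n`
  -- brings them into the form required by the axiom.
  have hmove : β.localTrace γ (⋃ i ∈ Finset.univ.filter fun i => ¬ σ i = i, piece K Y i) = 0 := by
    let e := (Fintype.equivFin {i // ¬ σ i = i}).symm
    let τ : Equiv.Perm {i // ¬ σ i = i} := σ.subtypePerm fun i => by
      simp [σ.injective.eq_iff]
    have h1 := β.trace_permuted γ _ (fun j => piece K Y (e j).1) ((e.trans τ).trans e.symm)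
      (fun j => h.smul_mem _ _)
      (fun i j hij => h.disjoint_piece fun h => hij (e.injective (Subtype.ext h)))
      (fun j => by simp [hσ, τ])
      (fun j hj => (e j).2 (by
        have := congrArg (fun k => (e k).1) hj
        simpa [τ] using this))
    have h2 : ⋃ j, piece K Y (e j).1 = ⋃ i ∈ Finset.univ.filter fun i => ¬ σ i = i, piece K Y i := by
      rw [e.surjective.iUnion_comp (fun i : {i // ¬ σ i = i} => piece K Y i.1), Set.iUnion_subtype]
      simp
    rw [h2] at h1
    exact h1
  have hstU (p : (Σ d, Γ ⧸ K d) → Prop) [DecidablePred p] (hp : ∀ i, p (σ i) ↔ p i) :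
      γ • (⋃ i ∈ Finset.univ.filter p, piece K Y i) = ⋃ i ∈ Finset.univ.filter p, piece K Y i := by
    simp only [Set.smul_set_iUnion, hσ, Finset.mem_filter, Finset.mem_univ, true_and]
    rw [← σ.surjective.iUnion_comp (fun i => ⋃ (_ : p i), piece K Y i)]
    simp only [hp]
  have hunion : (⋃ i ∈ Finset.univ.filter fun i => σ i = i, piece K Y i) ∪
      (⋃ i ∈ Finset.univ.filter fun i => ¬ σ i = i, piece K Y i) = F := by
    rw [← Finset.set_biUnion_union, Finset.filter_union_filter_not_eq, ← h.iUnion_piece]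
    simp
  have hdisj : Disjoint (⋃ i ∈ Finset.univ.filter fun i => ¬ σ i = i, piece K Y i)
      (⋃ i ∈ Finset.univ.filter fun i => σ i = i, piece K Y i) := by
    simp only [Set.disjoint_iUnion_left, Set.disjoint_iUnion_right]
    intro i hi j hj
    refine h.disjoint_piece ?_
    rintro rfl
    exact absurd (Finset.mem_filter.1 hi).2 (Finset.mem_filter.1 hj).2
  have hLHS : β.localTrace γ F = ∑ i ∈ Finset.univ.filter fun i => σ i = i,
      β.localTrace γ (piece K Y i) := by
    rw [hadd' F ⟨hFB, hFst.ge (Subgroup.mem_top γ)⟩ _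
      ⟨hmem _, hstU (fun i => σ i = i) fun i => σ.injective.eq_iff⟩
      (hunion ▸ Set.subset_union_left), hfix]
    conv_lhs => rw [← hunion]
    rw [Set.union_sdiff_left, hdisj.sdiff_eq_left, hmove, add_zero]
  rw [hLHS, Finset.sum_filter, Fintype.sum_sigma]
  refine Finset.sum_congr rfl fun d _ => ?_
  rw [trace_lTensor_ind]
  -- The Frobenius summand at y depends only on the coset of y, so the sum over Γ is |K_d| times a
  -- sum over cosets, which cancels the normalising factor.
  let φ (q : Γ ⧸ K d) : A := if γ • q = q then β.localTrace γ (piece K Y ⟨d, q⟩) else 0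
  have hterm (y : Γ) : traceExtend (K d) (y⁻¹ * γ * y) (β.val (K d) (Y d)) =
      φ (QuotientGroup.mk y) := by
    have hiff : y⁻¹ * γ * y ∈ K d ↔ γ • (QuotientGroup.mk y : Γ ⧸ K d) = QuotientGroup.mk y := by
      rw [eq_comm, mul_assoc]
      exact (QuotientGroup.eq (s := K d)).symm
    unfold traceExtend
    simp only [hiff, φ]
    split_ifs with hq
    · have hK := hiff.2 hq
      rw [trace_val β (hYB d) (h.stabilizer_eq d).ge, h.piece_mk,
        ← β.localTrace_smul y (hYB d) (h.smul_mem d y) (by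
          rw [← MulAction.mem_stabilizer_iff, h.stabilizer_eq]; exact hK)]
      congr 1
      group
    · rfl
  rw [Finset.sum_congr rfl fun y _ => hterm y, sum_quotient_mk (K d) φ,
    ← Nat.cast_smul_eq_nsmul ℂ, smul_smul, inv_mul_cancel₀, one_smul]
  · refine Finset.sum_congr rfl fun q _ => ?_
    refine if_congr ?_ rfl rfl
    simp [σ]
  · exact Nat.cast_ne_zero.2 Nat.card_pos.ne'

end AdditiveFunctor

end MilnorDecomp

namespace MilnorDecomp

open MvPolynomial

variable {l : ℕ}

/-! ### Constructible sets -/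

/-- The Boolean algebra of constructible subsets of `ℂ^l`. -/
noncomputable abbrev constructibleAlgebra (l : ℕ) : BooleanSubalgebra (Set (Fin l → ℂ)) :=
  BooleanSubalgebra.closure
    (Set.range fun p : MvPolynomial (Fin l) ℂ => {v | MvPolynomial.eval v p = 0})

theorem setOf_eval_eq_zero_mem (p : MvPolynomial (Fin l) ℂ) :
    {v | eval v p = 0} ∈ constructibleAlgebra l :=
  BooleanSubalgebra.subset_closure ⟨p, rfl⟩

theorem iInter_mem_constructibleAlgebra {ι : Type*} [Finite ι] {s : ι → Set (Fin l → ℂ)}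
    (hs : ∀ i, s i ∈ constructibleAlgebra l) : ⋂ i, s i ∈ constructibleAlgebra l := by
  have := Fintype.ofFinite ι
  rw [← Set.iInf_eq_iInter, ← Finset.inf_univ_eq_iInf]
  exact Finset.inf_mem (constructibleAlgebra l : Set (Set (Fin l → ℂ))) BooleanSubalgebra.top_mem
    (fun x hx y hy => BooleanSubalgebra.inf_mem hx hy) _ _ fun i _ => hs i

theorem iUnion_mem_constructibleAlgebra {ι : Type*} [Finite ι] {s : ι → Set (Fin l → ℂ)}
    (hs : ∀ i, s i ∈ constructibleAlgebra l) : ⋃ i, s i ∈ constructibleAlgebra l := by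
  rw [← compl_compl (⋃ i, s i), Set.compl_iUnion]
  exact BooleanSubalgebra.compl_mem
    (iInter_mem_constructibleAlgebra fun i => BooleanSubalgebra.compl_mem (hs i))

theorem eigenspace_mem_constructibleAlgebra (g : (Fin l → ℂ) ≃ₗ[ℂ] (Fin l → ℂ)) (c : ℂ) :
    (eigenspace g c : Set (Fin l → ℂ)) ∈ constructibleAlgebra l := by
  have h : (eigenspace g c : Set (Fin l → ℂ)) = ⋂ i, {v | eval v (linearFormPoly
      (LinearMap.proj i ∘ₗ ((g : (Fin l → ℂ) →ₗ[ℂ] (Fin l → ℂ)) - c • LinearMap.id))) = 0} := by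
    ext v
    simp [mem_eigenspace, _root_.funext_iff, sub_eq_zero]
  rw [h]
  exact iInter_mem_constructibleAlgebra fun i => setOf_eval_eq_zero_mem _

theorem milnorFibre_mem_constructibleAlgebra (q : MvPolynomial (Fin l) ℂ) :
    milnorFibre q ∈ constructibleAlgebra l := by
  have h : milnorFibre q = {v | eval v (q - 1) = 0} := by
    ext v
    simp [milnorFibre, sub_eq_zero]
  rw [h]
  exact setOf_eval_eq_zero_mem _

/-- The preimage of a constructible set under a linear map is constructible. -/
theorem preimage_mem_constructibleAlgebra (φ : (Fin l → ℂ) →ₗ[ℂ] (Fin l → ℂ))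
    {s : Set (Fin l → ℂ)} (hs : s ∈ constructibleAlgebra l) :
    φ ⁻¹' s ∈ constructibleAlgebra l := by
  -- Preimage respects the Boolean operations, so only zero sets of polynomials need checking.
  let Φ : BoundedLatticeHom (Set (Fin l → ℂ)) (Set (Fin l → ℂ)) :=
    { toFun := Set.preimage φ
      map_sup' := fun _ _ => rfl
      map_inf' := fun _ _ => rfl
      map_top' := rfl
      map_bot' := rfl }
  have h : constructibleAlgebra l ≤ (constructibleAlgebra l).comap Φ := by
    refine BooleanSubalgebra.closure_le.2 ?_
    rintro _ ⟨p, rfl⟩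
    change {v | eval (φ v) p = 0} ∈ constructibleAlgebra l
    simp only [← eval_linSubst]
    exact setOf_eval_eq_zero_mem _
  exact h hs

variable {G : Subgroup ((Fin l → ℂ) ≃ₗ[ℂ] (Fin l → ℂ))} {m : ℕ}

theorem smul_mem_constructibleAlgebra (γ : Gam G m) {s : Set (Fin l → ℂ)}
    (hs : s ∈ constructibleAlgebra l) : γ • s ∈ constructibleAlgebra l := by
  have h : γ • s = ((((((γ⁻¹).2⁻¹ : rootsOfUnity m ℂ) : ℂˣ) : ℂ) •
      (((γ⁻¹).1 : (Fin l → ℂ) ≃ₗ[ℂ] (Fin l → ℂ)) : (Fin l → ℂ) →ₗ[ℂ] (Fin l → ℂ)))) ⁻¹' s := by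
    ext v
    rw [Set.mem_smul_set_iff_inv_smul_mem]
    rfl
  rw [h]
  exact preimage_mem_constructibleAlgebra _ hs

theorem eigenUnion_mem_constructibleAlgebra [Finite G] (d : ℕ) :
    eigenUnion G d ∈ constructibleAlgebra l := by
  have h : eigenUnion G d = ⋃ g : G, (eigenspace g.1 (zeta d) : Set (Fin l → ℂ)) := by
    ext v
    simp [eigenUnion]
  rw [h]
  exact iUnion_mem_constructibleAlgebra fun g : G => eigenspace_mem_constructibleAlgebra _ _

theorem openStratum_mem_constructibleAlgebra [Finite G] (deg : Fin l → ℕ) {F : Set (Fin l → ℂ)}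
    (hF : F ∈ constructibleAlgebra l) (d : ℕ) : openStratum G deg F d ∈ constructibleAlgebra l := by
  rw [openStratum, Set.biUnion_eq_iUnion]
  have : Finite {e | e ∈ regularPoset G deg ∧ d ∣ e ∧ e ≠ d} :=
    (finite_regularPoset G deg).subset fun e he => he.1
  exact BooleanSubalgebra.sdiff_mem
    (BooleanSubalgebra.inf_mem hF (eigenUnion_mem_constructibleAlgebra d))
    (iUnion_mem_constructibleAlgebra fun _ =>
      BooleanSubalgebra.inf_mem hF (eigenUnion_mem_constructibleAlgebra _))

/-- `F` is the disjoint union of the translates of the `(F ∩ E_d)°`. -/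
theorem IsInvariantDiscriminant.isInducedPartition [Finite G] [NeZero m]
    {q : MvPolynomial (Fin l) ℂ} (hq : IsInvariantDiscriminant G m q) {deg : Fin l → ℕ}
    {f : Fin l → MvPolynomial (Fin l) ℂ} (hf : IsBasicInvariants G deg f) (g : ℕ → G)
    (hE : ∀ d ∈ regularPoset G deg,
      IsMaximalEigenspace G (zeta d) (eigenspace (g d : (Fin l → ℂ) ≃ₗ[ℂ] _) (zeta d))) :
    IsInducedPartition (constructibleSubsets (milnorFibre q))
      (fun d : regularPoset G deg => gamCentralizer m (g d))
      (fun d : regularPoset G deg => openStratum G deg (milnorFibre q) d ∩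
        eigenspace (g d : (Fin l → ℂ) ≃ₗ[ℂ] _) (zeta d)) (milnorFibre q) where
  empty_mem := ⟨Set.empty_subset _, BooleanSubalgebra.bot_mem⟩
  union_mem s hs t ht := ⟨Set.union_subset hs.1 ht.1, BooleanSubalgebra.sup_mem hs.2 ht.2⟩
  smul_mem d γ := by
    refine ⟨?_, smul_mem_constructibleAlgebra γ (BooleanSubalgebra.inf_mem
      (openStratum_mem_constructibleAlgebra deg (milnorFibre_mem_constructibleAlgebra q) d)
      (eigenspace_mem_constructibleAlgebra _ _))⟩
    rintro _ ⟨v, hv, rfl⟩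
    exact (hq.gam_smul_mem_iff γ v).2 hv.1.1.1
  stabilizer_eq d := hq.stabilizer_openStratum_inter hf d.2 _ (hE d d.2)
  eq_and_mem d d' γ v hv hv' := by
    have h := ((hq.mem_openStratum_iff hf d'.2).1 hv'.1).2
    rw [gam_orbitGcd_smul hf, ((hq.mem_openStratum_iff hf d.2).1 hv.1).2] at h
    obtain rfl : d = d' := Subtype.ext h
    exact ⟨rfl, (hq.gam_smul_mem_inter_iff hf d.2 _ γ hv).1 hv'⟩
  mem_iff v := by
    constructor
    · intro hv
      obtain ⟨d, hd, γ, h⟩ := hq.exists_mem_smul_openStratum_inter hf g hE hv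
      exact ⟨⟨d, hd⟩, γ, h⟩
    · rintro ⟨d, γ, h⟩
      exact (hq.gam_smul_mem_iff γ v).1 h.1.1.1

end MilnorDecomp

/-! ### The equivariant decomposition of the Milnor fibre. -/

theorem mainTheorem3 {l : ℕ} (G : Subgroup ((Fin l → ℂ) ≃ₗ[ℂ] (Fin l → ℂ))) [Finite G]
    (hG : IsReflectionGroup G)
    (form : Submodule ℂ (Fin l → ℂ) → ((Fin l → ℂ) →ₗ[ℂ] ℂ))
    (hform : ∀ H ∈ hyperplanes G, LinearMap.ker (form H) = H)
    (m : ℕ) [NeZero m] (hm : (definingPoly G form).totalDegree = m)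
    (F : Set (Fin l → ℂ)) (hF : F = milnorFibre (definingPoly G form))
    (deg : Fin l → ℕ) (hdeg : IsInvariantDegrees G deg)
    (g : ℕ → G) (E : ℕ → Submodule ℂ (Fin l → ℂ))
    (hE : ∀ d ∈ regularPoset G deg, IsMaximalEigenspace G (zeta d) (E d))
    (hg : ∀ d ∈ regularPoset G deg, E d = eigenspace (g d) (zeta d))
    (Y : ℕ → Set (Fin l → ℂ)) (hY : ∀ d, Y d = openStratum G deg F d ∩ E d) :
    -- `F` is stable under `Γ`, `𝒫` is finite, and `Γ(d)` is the stabiliser of `(F ∩ E_d)°`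
    MulAction.stabilizer (Gam G m) F = ⊤ ∧
    (regularPoset G deg).Finite ∧
    (∀ d ∈ regularPoset G deg, MulAction.stabilizer (Gam G m) (Y d) = gamCentralizer m (g d)) ∧
    -- the induction formula for additive functors with values in the rings `A ⊗ R(H)`, `H ≤ Γ`
    (∀ (A : Type*) [CommRing A] [Algebra ℂ A]
      (β : AdditiveFunctor (Gam G m) (constructibleSubsets F) A),
      β.val ⊤ F = ∑ᶠ d ∈ regularPoset G deg,
        LinearMap.lTensor A (RepRing.ind (le_top : gamCentralizer m (g d) ≤ ⊤))
          (β.val (gamCentralizer m (g d)) (Y d))) ∧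
    -- its form for additive equivariant functions with values in a single `Γ`-module `S`
    (∀ (S : Type*) [AddCommGroup S] [DistribMulAction (Gam G m) S] (β : Set (Fin l → ℂ) → S),
      (∀ X ∈ constructibleSubsets F, ∀ Z ∈ constructibleSubsets F, Z ⊆ X →
        β X = β Z + β (X \ Z)) →
      (∀ (γ : Gam G m), ∀ X ∈ constructibleSubsets F, β (γ • X) = γ • β X) →
      β F = ∑ᶠ d ∈ regularPoset G deg,
        ∑ᶠ q : Gam G m ⧸ gamCentralizer m (g d), q.out • β (Y d)) ∧
    -- `(g_d, ζ_d) ∈ Γ`, and `Γ(d) / R(d)` acts freely on `(F ∩ E_d)°`, `R(d) = ⟨(g_d, ζ_d)⟩`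
    (∀ d ∈ regularPoset G deg, ∃ ξ : rootsOfUnity m ℂ, ((ξ : ℂˣ) : ℂ) = zeta d ∧
      Subgroup.zpowers ((g d, ξ) : Gam G m) ≤ gamCentralizer m (g d) ∧
      ((Subgroup.zpowers ((g d, ξ) : Gam G m)).subgroupOf (gamCentralizer m (g d))).Normal ∧
      ∀ v ∈ Y d, ∀ γ ∈ gamCentralizer m (g d),
        γ • v = v ↔ γ ∈ Subgroup.zpowers ((g d, ξ) : Gam G m)) := by

  obtain ⟨f, hf1, hf2, hf3⟩ := hdeg
  have hf : IsBasicInvariants G deg f := ⟨hf1, hf2, hf3⟩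
  have hq : IsInvariantDiscriminant G m (definingPoly G form) :=
    ⟨definingPoly_isHomogeneous hm, fun g hg v => eval_definingPoly_apply hG hform hg v,
      eval_definingPoly_ne_zero_iff hform⟩
  have hE' : ∀ d ∈ regularPoset G deg, IsMaximalEigenspace G (zeta d)
      (eigenspace (g d : (Fin l → ℂ) ≃ₗ[ℂ] _) (zeta d)) := fun d hd => hg d hd ▸ hE d hd
  have hY' : ∀ d ∈ regularPoset G deg, Y d = openStratum G deg (milnorFibre (definingPoly G form)) d ∩
      eigenspace (g d : (Fin l → ℂ) ≃ₗ[ℂ] _) (zeta d) := fun d hd => by rw [hY, hF, hg d hd]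
  have hfin := finite_regularPoset G deg
  have : Finite (regularPoset G deg) := hfin
  subst hF
  have hpart : IsInducedPartition (constructibleSubsets (milnorFibre (definingPoly G form)))
      (fun d : regularPoset G deg => gamCentralizer m (g d)) (fun d : regularPoset G deg => Y d)
      (milnorFibre (definingPoly G form)) := by
    convert! hq.isInducedPartition hf g hE' using 2 with d
    exact hY' d d.2
  refine ⟨hq.stabilizer_milnorFibre, hfin, fun d hd => ?_, fun A _ _ β => ?_,
    fun S _ _ β hadd hsmul => ?_, fun d hd => ?_⟩
  · rw [hY' d hd]
    exact hq.stabilizer_openStratum_inter hf hd _ (hE' d hd)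
  · rw [β.val_top_eq_finsum hpart]
    exact finsum_set_coe_eq_finsum_mem (f := fun d => LinearMap.lTensor A
      (RepRing.ind (le_top : gamCentralizer m (g d) ≤ ⊤)) (β.val (gamCentralizer m (g d)) (Y d))) _
  · rw [hpart.apply_eq_finsum hadd hsmul]
    exact finsum_set_coe_eq_finsum_mem (f := fun d =>
      ∑ᶠ q : Gam G m ⧸ gamCentralizer m (g d), q.out • β (Y d)) _
  · rw [hY' d hd]
    exact hq.exists_rootsOfUnity_eq_zeta hf hd _ (hE' d hd)
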